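/- Consider a single-station queue with $\ell$ customer classes, arrival rates $\lambda_i\ge 0$, exponential service rates $\mu_i>0$, and a routing matrix $R$ ($R_{ij}\ge 0$, row sums at most $1$; a served class-$i$ customer becomes class $j$ with probability $R_{ij}$ and leaves with probability $1-\sum_j R_{ij}$). Assume that $R$ is transient, i.e. $\sum_k R^k$ converges, that $\gamma=(I-R')^{-1}\lambda$ has positive entries, and that time is scaled so that $\sum_i(\lambda_i+\mu_i)=1$. Put $Q=\mathrm{diag}(\mu)^{-1}(I-R')^{-1}$, $d'=e'Q$, with $e$ the vector of ones, and let $f(y)=d'y$ be the workload. Assume $e'Q\lambda=1$. For each $\rho\in(0,1)$ consider the system with arrival rates $\rho\lambda$, operated under any stationary non-idling work-allocation policy $w=w_\rho$: $w_i(y)\ge0$, $\sum_i w_i(y)\le 1$, $w_i(y)=0$ if $y_i=0$, and $\sum_i w_i(y)=1$ if $y\ne0$. Let $Y$ be its uniformized chain on $\mathbb{Z}_+^\ell$: from $y$ it moves to $y+e_i$ with probability $\rho\lambda_i$, to $y-e_i+e_j$ with probability $\mu_iw_i(y)R_{ij}$, to $y-e_i$ with probability $\mu_iw_i(y)(1-\sum_jR_{ij})$,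 and otherwise stays at $y$. Write $P$ for its transition operator, $|y|=\sum_i |y_i|$, and $\bar Y(n)=n^{-1}\sum_{k=0}^{n-1}Y(k)$. Then for every $\rho\in(0,1)$: 1. The function $V=b f^5+1$ satisfies Assumption (A) for every sufficiently large constant $b$ (depending on $\rho$): $V\ge 0$ on $\mathbb{R}_+^\ell$; $\delta(|x|^5+1)\le V(x)\le\delta^{-1}(|x|^5+1)$ for some $\delta\in(0,1)$ and all $x\in\mathbb{R}_+^\ell$; and $PV(y)-V(y)\le-|y|^4+\eta$ for some $\eta>0$ and all $y\in\mathbb{Z}_+^\ell$. The chain has a unique stationary distribution $\pi_\rho$. For the stationary chain the time-average variance constants $\sigma_f^2(\rho)=\lim_n n\,\mathrm{Var}(f(\bar Y(n)))$ and $\sigma_i^2(\rho)=\lim_n n\,\mathrm{Var}(\bar Y_i(n))$, and the time-average covariance matrix $\Sigma_\rho=\lim_n n\,\mathrm{Cov}(\bar Y(n))$, exist and are finite, with $\sigma_f^2(\rho)=d'\Sigma_\rho d$ and $\sigma_i^2(\rho)=(\Sigma_\rho)_{ii}$. 2. There is a vector $c_\rho$ such that $$h(y;\rho)=\frac{f(y)^2}{2(1-\rho)}+c_\rho'y$$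 is a $\pi_\rho$-integrable solution of Poisson's equation $Ph-h=-f+\pi_\rho(f)$ on $\mathbb{Z}_+^\ell$, and every $\pi_\rho$-integrable solution agrees with it $\pi_\rho$-almost everywhere up to an additive constant. The vector $c_\rho$ is of order $(1-\rho)^{-1}$: there are constants $k_1,k_2>0$, independent of $\rho$, with $k_1(1-\rho)^{-1}\le|c_\rho|\le k_2(1-\rho)^{-1}$ for all $\rho\in(0,1)$. Furthermore, there are constants $A,B,A'>0$, independent of $\rho$, such that for all $\rho<1$ sufficiently close to $1$, $$\frac{A}{(1-\rho)^4}\le\sigma_f^2(\rho)\le\frac{B}{(1-\rho)^4}\qquad\text{and}\qquad \mathrm{trace}\,\Sigma_\rho=\sum_{i=1}^\ell\sigma_i^2(\rho)\ge\frac{A'}{(1-\rho)^4}.$$ -/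

import Mathlib

open MeasureTheory ProbabilityTheory Filter Topology Matrix

/-- Data of a multiclass queue with a single station and `ℓ` customer classes: arrival rates,
service rates and a transient routing matrix. The unit of time is the mean time between two
events of the uniformized system, i.e. all rates add up to one. -/
structure Station (ℓ : ℕ) where
  arrival : Fin ℓ → ℝ
  service : Fin ℓ → ℝ
  routing : Matrix (Fin ℓ) (Fin ℓ) ℝ
  arrival_nonneg : ∀ i, 0 ≤ arrival i
  service_pos : ∀ i, 0 < service i
  routing_nonneg : ∀ i j, 0 ≤ routing i j
  routing_row_le_one : ∀ i, ∑ j, routing i j ≤ 1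
  /-- Every customer eventually leaves. -/
  transient : Summable fun k : ℕ => routing ^ k
  /-- The solution of the traffic equations `0 = arrival - γ + routingᵀ γ` is positive. -/
  traffic_pos : ∀ i, 0 < ((1 - routingᵀ)⁻¹ *ᵥ arrival) i
  time_scale : ∑ i, (arrival i + service i) = 1

/-- A stationary non-idling allocation: `alloc y i` is the fraction of the effort of the station
that is given to class `i` when the vector of buffer levels is `y`. Only customers who are
present can be served, and all the effort is used as soon as a customer is present. -/
structure NonIdlingPolicy (ℓ : ℕ) where
  alloc : (Fin ℓ → ℕ) → Fin ℓ → ℝ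
  alloc_nonneg : ∀ y i, 0 ≤ alloc y i
  alloc_sum_le_one : ∀ y, ∑ i, alloc y i ≤ 1
  alloc_of_empty : ∀ y i, y i = 0 → alloc y i = 0
  nonidling : ∀ y, y ≠ 0 → ∑ i, alloc y i = 1

namespace Station

variable {ℓ : ℕ} (N : Station ℓ)

/-- `Q = diag(service)⁻¹ (1 - routingᵀ)⁻¹`. -/
noncomputable def Q : Matrix (Fin ℓ) (Fin ℓ) ℝ :=
  (Matrix.diagonal N.service)⁻¹ * (1 - N.routingᵀ)⁻¹

/-- The workload vector `d' = e' Q`. -/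
noncomputable def d : Fin ℓ → ℝ := (1 : Fin ℓ → ℝ) ᵥ* N.Q

/-- The workload `f y = d' y`. -/
noncomputable def f (y : Fin ℓ → ℝ) : ℝ := N.d ⬝ᵥ y

/-- The law of the next state of the uniformized chain of the system with arrival rates
`ρ * arrival`: an arrival, a service completion followed by a transition to another class or by
a departure, or no change at all. -/
noncomputable def step (ρ : ℝ) (w : NonIdlingPolicy ℓ) (y : Fin ℓ → ℕ) :
    Measure (Fin ℓ → ℕ) :=
  ∑ i, ENNReal.ofReal (ρ * N.arrival i) • Measure.dirac (y + Pi.single i 1)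
  + ∑ i, ∑ j, ENNReal.ofReal (N.service i * w.alloc y i * N.routing i j) •
      Measure.dirac (y - Pi.single i 1 + Pi.single j 1)
  + ∑ i, ENNReal.ofReal (N.service i * w.alloc y i * (1 - ∑ j, N.routing i j)) •
      Measure.dirac (y - Pi.single i 1)
  + ENNReal.ofReal (1 - ∑ i, ρ * N.arrival i - ∑ i, N.service i * w.alloc y i) •
      Measure.dirac y

/-- The transition kernel of the uniformized chain `Y` at load `ρ`. -/
noncomputable def kernel (ρ : Set.Ioo (0 : ℝ) 1) (w : NonIdlingPolicy ℓ) :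
    Kernel (Fin ℓ → ℕ) (Fin ℓ → ℕ) where
  toFun := N.step ρ w
  measurable' := measurable_of_countable _

theorem alloc_le_one (w : NonIdlingPolicy ℓ) (y : Fin ℓ → ℕ) (i : Fin ℓ) :
    w.alloc y i ≤ 1 :=
  (Finset.single_le_sum (f := w.alloc y) (fun j _ => w.alloc_nonneg y j)
    (Finset.mem_univ i)).trans (w.alloc_sum_le_one y)

theorem step_univ (ρ : Set.Ioo (0 : ℝ) 1) (w : NonIdlingPolicy ℓ) (y : Fin ℓ → ℕ) :
    N.step ρ w y Set.univ = 1 := by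
  obtain ⟨ρ, hρ0, hρ1⟩ := ρ
  have ha : ∀ i, 0 ≤ ρ * N.arrival i := fun i => mul_nonneg hρ0.le (N.arrival_nonneg i)
  have hs : ∀ i, 0 ≤ N.service i * w.alloc y i := fun i =>
    mul_nonneg (N.service_pos i).le (w.alloc_nonneg y i)
  have hr : ∀ i j, 0 ≤ N.service i * w.alloc y i * N.routing i j := fun i j =>
    mul_nonneg (hs i) (N.routing_nonneg i j)
  have hx : ∀ i, 0 ≤ N.service i * w.alloc y i * (1 - ∑ j, N.routing i j) := fun i =>
    mul_nonneg (hs i) (sub_nonneg.2 (N.routing_row_le_one i))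
  have hle : ∑ i, ρ * N.arrival i + ∑ i, N.service i * w.alloc y i ≤ 1 := by
    rw [← N.time_scale, ← Finset.sum_add_distrib]
    refine Finset.sum_le_sum fun i _ => add_le_add ?_ ?_
    · exact mul_le_of_le_one_left (N.arrival_nonneg i) hρ1.le
    · exact mul_le_of_le_one_right (N.service_pos i).le (alloc_le_one w y i)
  have h0 : 0 ≤ 1 - ∑ i, ρ * N.arrival i - ∑ i, N.service i * w.alloc y i := by linarith
  have hsum : ∑ i, ∑ j, N.service i * w.alloc y i * N.routing i j
      + ∑ i, N.service i * w.alloc y i * (1 - ∑ j, N.routing i j)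
      = ∑ i, N.service i * w.alloc y i := by
    rw [← Finset.sum_add_distrib]
    refine Finset.sum_congr rfl fun i _ => ?_
    rw [← Finset.mul_sum]
    ring
  simp only [step, Measure.add_apply, Measure.finsetSum_apply, Measure.smul_apply,
    measure_univ, smul_eq_mul, mul_one]
  rw [← ENNReal.ofReal_sum_of_nonneg fun i _ => ha i,
    ← ENNReal.ofReal_sum_of_nonneg fun i _ => hx i]
  simp_rw [← ENNReal.ofReal_sum_of_nonneg fun j _ => hr _ j]
  rw [← ENNReal.ofReal_sum_of_nonneg fun i _ => Finset.sum_nonneg fun j _ => hr i j,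
    ← ENNReal.ofReal_add (Finset.sum_nonneg fun i _ => ha i)
      (Finset.sum_nonneg fun i _ => Finset.sum_nonneg fun j _ => hr i j),
    add_assoc (ENNReal.ofReal _) (ENNReal.ofReal _) (ENNReal.ofReal _),
    ← ENNReal.ofReal_add (Finset.sum_nonneg fun i _ => hx i) h0,
    ← ENNReal.ofReal_add (add_nonneg (Finset.sum_nonneg fun i _ => ha i)
      (Finset.sum_nonneg fun i _ => Finset.sum_nonneg fun j _ => hr i j))
      (add_nonneg (Finset.sum_nonneg fun i _ => hx i) h0)]
  rw [ENNReal.ofReal_eq_one]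
  linarith

instance (ρ : Set.Ioo (0 : ℝ) 1) (w : NonIdlingPolicy ℓ) : IsMarkovKernel (N.kernel ρ w) :=
  ⟨fun y => ⟨N.step_univ ρ w y⟩⟩

end Station

section Chain

variable {ℓ : ℕ}

/-- The vector of buffer levels as a real vector. -/
def levels (y : Fin ℓ → ℕ) : Fin ℓ → ℝ := fun i => (y i : ℝ)

/-- The drift `Δ_V y = E_y V(Y(1)) - V y`. -/
noncomputable def drift (K : Kernel (Fin ℓ → ℕ) (Fin ℓ → ℕ)) (V : (Fin ℓ → ℕ) → ℝ)
    (y : Fin ℓ → ℕ) : ℝ :=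
  ∫ z, V z ∂(K y) - V y

/-- Assumption (A) holds with the function `V`, defined on the nonnegative orthant: `V` is
equivalent to a quintic, and its drift is at most `-|y|⁴ + η`, where `|y|` is the `ℓ¹` norm. -/
def SatisfiesA (K : Kernel (Fin ℓ → ℕ) (Fin ℓ → ℕ)) (V : (Fin ℓ → ℝ) → ℝ) : Prop :=
  (∀ x : Fin ℓ → ℝ, 0 ≤ x → 0 ≤ V x) ∧
  (∃ δ : ℝ, 0 < δ ∧ δ < 1 ∧ ∀ x : Fin ℓ → ℝ, 0 ≤ x →
    δ * ((∑ i, |x i|) ^ 5 + 1) ≤ V x ∧ V x ≤ δ⁻¹ * ((∑ i, |x i|) ^ 5 + 1)) ∧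
  ∃ η : ℝ, 0 < η ∧ ∀ y : Fin ℓ → ℕ,
    drift K (fun z => V (levels z)) y ≤ -(∑ i, |levels y i|) ^ 4 + η

/-- `π` is a stationary distribution, and it is the only one. -/
def IsUniqueStationary (K : Kernel (Fin ℓ → ℕ) (Fin ℓ → ℕ)) (π : Measure (Fin ℓ → ℕ)) : Prop :=
  IsProbabilityMeasure π ∧ Kernel.Invariant K π ∧
  ∀ ν : Measure (Fin ℓ → ℕ), IsProbabilityMeasure ν → Kernel.Invariant K ν → ν = π

/-- `h` is a `π`-integrable solution of Poisson's equation `Δ_h = -F + π(F)` for `F`. -/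
def IsPoissonSolution (K : Kernel (Fin ℓ → ℕ) (Fin ℓ → ℕ)) (π : Measure (Fin ℓ → ℕ))
    (F h : (Fin ℓ → ℕ) → ℝ) : Prop :=
  Integrable F π ∧ Integrable h π ∧ ∀ y, drift K h y = -F y + ∫ z, F z ∂π

/-- The law, on the space of paths, of the Markov chain with transition kernel `K` and
initial distribution `π`. -/
noncomputable def chainLaw (K : Kernel (Fin ℓ → ℕ) (Fin ℓ → ℕ)) [IsMarkovKernel K]
    (π : Measure (Fin ℓ → ℕ)) : Measure (ℕ → Fin ℓ → ℕ) :=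
  Kernel.trajMeasure (X := fun _ => Fin ℓ → ℕ) π fun n =>
    K.comap (fun x : (Π _ : Finset.Iic n, Fin ℓ → ℕ) => x ⟨n, Finset.mem_Iic.2 le_rfl⟩)
      (measurable_pi_apply _)

/-- The sample mean `n⁻¹ (Y(0) + ⋯ + Y(n - 1))`. -/
noncomputable def sampleMean (n : ℕ) (Y : ℕ → Fin ℓ → ℕ) : Fin ℓ → ℝ :=
  (n : ℝ)⁻¹ • ∑ k ∈ Finset.range n, levels (Y k)

/-- For a linear functional `g`, the number `s` is the time-average variance constant of the
estimator `g` of the sample mean: the limit of `n` times its variance in the stationary chain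
(finite, with second moments in equilibrium). -/
def IsTAVC (K : Kernel (Fin ℓ → ℕ) (Fin ℓ → ℕ)) [IsMarkovKernel K]
    (π : Measure (Fin ℓ → ℕ)) (g : (Fin ℓ → ℝ) → ℝ) (s : ℝ) : Prop :=
  MemLp (fun y => g (levels y)) 2 π ∧
  Tendsto (fun n : ℕ => (n : ℝ) * Var[fun Y => g (sampleMean n Y); chainLaw K π]) atTop (𝓝 s)

/-- `C` is the time-average covariance matrix of the chain: the limit of `n` times the covariance
matrix of the sample mean in the stationary chain. -/
def IsTimeAverageCovariance (K : Kernel (Fin ℓ → ℕ) (Fin ℓ → ℕ)) [IsMarkovKernel K]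
    (π : Measure (Fin ℓ → ℕ)) (C : Matrix (Fin ℓ) (Fin ℓ) ℝ) : Prop :=
  (∀ i, MemLp (fun y => levels y i) 2 π) ∧
  ∀ i j, Tendsto (fun n : ℕ => (n : ℝ) *
    cov[fun Y => sampleMean n Y i, fun Y => sampleMean n Y j; chainLaw K π]) atTop (𝓝 (C i j))

end Chain

/-!
The chain has bounded increments, and the workload `f` has drift `-(1 - ρ)` off the empty state,
because `d i - ∑ j, R i j * d j = 1 / service i` makes every service completion remove one unit of
work per unit of effort on average, whatever the policy (`drift_quadratic`,
`integral_f_kernel_of_ne`). Hence the drift of `f ^ 5` is at most `-(1 - ρ) f ^ 4` plus a constant,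
which is Assumption (A).

Stationary distribution. Every state leads to the empty state `0` (`reach_zero`), so `0` is used as
an atom. The occupation measure of a cycle between visits to `0` is finite by the Foster-Lyapunov
bound `potential_le_of_drift`, and invariant (`invariant_cycleMeasure`). Uniqueness holds because
the minimum of two stationary distributions is stationary, and so are the two differences, one of
which does not charge `0` (`invariant_unique`). The same bound with the Lyapunov function `f ^ 5`
gives a finite fourth moment of the workload.

Poisson's equation. The drift of `f ^ 2 / (2 * (1 - ρ))` is `-f` plus a constant plus a term that
depends on the allocation; the linear function `c'y` is chosen to cancel this last term, class by
class (`drift_workloadSolution`). Uniqueness up to constants follows from the fact that an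
integrable harmonic function is constant: its distance to one of its values is subharmonic, hence
harmonic, so its level sets are closed under transitions (`ae_eq_const_of_harmonic`).

Variances. A square integrable solution `h` of Poisson's equation for `g` turns the centered sums of
`g` into a martingale plus a bounded-in-`L²` boundary term, so the time-average covariances are the
stationary covariances of the martingale increments (`tendsto_covariance_mean`). For the individual
buffer levels the solution is not explicit; it is the expected centered sum up to the next visit to
`0` (`poissonPotential`), which grows at most quadratically. For the workload, the explicit solution
gives an increment of size at most a multiple of `(f + 1) / (1 - ρ)`, and, at an arrival of class
`i`, of size at least `f * d i / (1 - ρ)` up to the mean workload. As the mean workload is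
`ρ * meanFactor / (2 * (1 - ρ))`, and its second moment is of order `(1 - ρ)⁻²` by the drift of
`f ^ 3`, the variance constant is of order `(1 - ρ)⁻⁴` (`workloadVariance_le`,
`le_workloadVariance`). The bound for the trace is the Cauchy-Schwarz inequality for a Gram matrix.
-/

/-! ### The chain killed on entering an atom -/

section Killed

open scoped ENNReal

variable {S : Type*} [MeasurableSpace S] [Countable S] [MeasurableSingletonClass S]

/-- The transition operator of the chain with kernel `K` that is killed on entering the state `a`,
on nonnegative functions. -/
noncomputable def killed (K : Kernel S S) (a : S) (φ : S → ℝ≥0∞) (y : S) : ℝ≥0∞ :=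
  ∫⁻ z in {a}ᶜ, φ z ∂(K y)

/-- The potential of `φ` for the chain killed on entering `a`: the expectation under `y` of the sum
of `φ` over the times `0 ≤ k < τ`, where `τ ≥ 1` is the first positive time spent in `a`. -/
noncomputable def potential (K : Kernel S S) (a : S) (φ : S → ℝ≥0∞) (y : S) : ℝ≥0∞ :=
  ∑' n, ((killed K a)^[n] φ) y

/-- The occupation measure of one cycle between visits to `a`. -/
noncomputable def cycleMeasure (K : Kernel S S) (a : S) : Measure S :=
  Measure.sum fun y => potential K a (Set.indicator {y} 1) a • Measure.dirac y

variable (K : Kernel S S) (a : S)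

omit [Countable S] [MeasurableSingletonClass S] in
theorem killed_mono {φ ψ : S → ℝ≥0∞} (h : φ ≤ ψ) : killed K a φ ≤ killed K a ψ :=
  fun _ => lintegral_mono h

theorem killed_add (φ ψ : S → ℝ≥0∞) : killed K a (φ + ψ) = killed K a φ + killed K a ψ := by
  funext y
  exact lintegral_add_left (measurable_of_countable _) _

theorem killed_tsum {ι : Type*} [Countable ι] (φ : ι → S → ℝ≥0∞) :
    killed K a (fun y => ∑' i, φ i y) = fun y => ∑' i, killed K a (φ i) y := by
  funext y
  exact lintegral_tsum fun i => (measurable_of_countable _).aemeasurable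

theorem killed_const_mul (c : ℝ≥0∞) (φ : S → ℝ≥0∞) :
    killed K a (fun y => c * φ y) = fun y => c * killed K a φ y := by
  funext y
  exact lintegral_const_mul _ (measurable_of_countable _)

omit [Countable S] [MeasurableSingletonClass S] in
theorem killed_le_lintegral (φ : S → ℝ≥0∞) (y : S) : killed K a φ y ≤ ∫⁻ z, φ z ∂(K y) :=
  setLIntegral_le_lintegral _ _

omit [Countable S] in
theorem killed_add_atom (φ : S → ℝ≥0∞) (y : S) :
    killed K a φ y + φ a * K y {a} = ∫⁻ z, φ z ∂(K y) := by
  rw [killed, ← lintegral_singleton φ a, add_comm]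
  exact lintegral_add_compl φ (measurableSet_singleton a)

theorem killed_iterate_tsum {ι : Type*} [Countable ι] (φ : ι → S → ℝ≥0∞) (n : ℕ) :
    (killed K a)^[n] (fun y => ∑' i, φ i y) = fun y => ∑' i, (killed K a)^[n] (φ i) y := by
  induction n with
  | zero => rfl
  | succ n ih => simp only [Function.iterate_succ_apply', ih, killed_tsum]

theorem killed_iterate_const_mul (c : ℝ≥0∞) (φ : S → ℝ≥0∞) (n : ℕ) :
    (killed K a)^[n] (fun y => c * φ y) = fun y => c * (killed K a)^[n] φ y := by
  induction n with
  | zero => rfl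
  | succ n ih => simp only [Function.iterate_succ_apply', ih, killed_const_mul]

theorem killed_iterate_add (φ ψ : S → ℝ≥0∞) (n : ℕ) :
    (killed K a)^[n] (φ + ψ) = (killed K a)^[n] φ + (killed K a)^[n] ψ := by
  induction n with
  | zero => rfl
  | succ n ih => simp only [Function.iterate_succ_apply', ih, killed_add]

theorem potential_tsum {ι : Type*} [Countable ι] (φ : ι → S → ℝ≥0∞) (y : S) :
    potential K a (fun y => ∑' i, φ i y) y = ∑' i, potential K a (φ i) y := by
  simp only [potential, killed_iterate_tsum]
  exact ENNReal.tsum_comm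

theorem potential_const_mul (c : ℝ≥0∞) (φ : S → ℝ≥0∞) (y : S) :
    potential K a (fun y => c * φ y) y = c * potential K a φ y := by
  simp only [potential, killed_iterate_const_mul, ENNReal.tsum_mul_left]

theorem potential_add (φ ψ : S → ℝ≥0∞) (y : S) :
    potential K a (φ + ψ) y = potential K a φ y + potential K a ψ y := by
  simp only [potential, killed_iterate_add, Pi.add_apply, ENNReal.tsum_add]

/-- First-step analysis of the potential. -/
theorem potential_eq_add_killed_potential (φ : S → ℝ≥0∞) (y : S) :
    potential K a φ y = φ y + killed K a (potential K a φ) y := by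
  have : potential K a φ = fun y => ∑' n, ((killed K a)^[n] φ) y := rfl
  rw [this, killed_tsum]
  dsimp only
  rw [tsum_eq_zero_add' ENNReal.summable]
  simp only [Function.iterate_succ_apply', Function.iterate_zero, id]

omit [Countable S] [MeasurableSingletonClass S] in
/-- Last-step analysis of the potential. -/
theorem potential_eq_add_potential_killed (φ : S → ℝ≥0∞) (y : S) :
    potential K a φ y = φ y + potential K a (killed K a φ) y := by
  rw [potential, potential, tsum_eq_zero_add' ENNReal.summable]
  simp only [Function.iterate_succ_apply, Function.iterate_zero, id]

/-- A supersolution of the equation for the potential dominates it. -/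
theorem potential_le_of_supersolution {φ W : S → ℝ≥0∞}
    (h : ∀ y, φ y + killed K a W y ≤ W y) (y : S) : potential K a φ y ≤ W y := by
  rw [potential, ENNReal.tsum_eq_iSup_nat]
  refine iSup_le fun n => ?_
  have key : ∀ n y, ∑ k ∈ Finset.range n, ((killed K a)^[k] φ) y + ((killed K a)^[n] W) y
      ≤ W y := by
    intro n
    induction n with
    | zero => intro y; simp
    | succ n ih =>
      intro y
      refine le_trans ?_ (ih y)
      rw [Finset.sum_range_succ, add_assoc]
      gcongr
      rw [Function.iterate_succ_apply]
      have := (Monotone.iterate (fun _ _ h => killed_mono K a h) n)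
        (show φ + killed K a W ≤ W from h) y
      rwa [killed_iterate_add] at this
  exact le_self_add.trans (key n y)

/-- The Foster-Lyapunov bound off the atom. -/
theorem potential_le_of_drift {φ W : S → ℝ≥0∞}
    (h : ∀ y, y ≠ a → φ y + ∫⁻ z, W z ∂(K y) ≤ W y) {y : S} (hy : y ≠ a) :
    potential K a φ y ≤ W y := by
  classical
  -- The killed operator does not see the value at `a`, so `W` may be replaced by `∞` there.
  have hk : ∀ y, killed K a (Function.update W a ∞) y ≤ ∫⁻ z, W z ∂(K y) := by
    intro y
    refine le_trans (le_of_eq ?_) (killed_le_lintegral K a W y)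
    refine setLIntegral_congr_fun (measurableSet_singleton a).compl fun z hz => ?_
    exact Function.update_of_ne hz _ _
  have := potential_le_of_supersolution K a (φ := φ) (W := Function.update W a ∞)
    (fun y => by
      by_cases hy : y = a
      · subst hy; simp
      · rw [Function.update_of_ne hy]
        exact (add_le_add le_rfl (hk y)).trans (h y hy)) y
  rwa [Function.update_of_ne hy] at this

theorem potential_atom_le_of_drift {φ W : S → ℝ≥0∞}
    (h : ∀ y, y ≠ a → φ y + ∫⁻ z, W z ∂(K y) ≤ W y) :
    potential K a φ a ≤ φ a + ∫⁻ z, W z ∂(K a) := by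
  rw [potential_eq_add_killed_potential]
  refine add_le_add le_rfl (le_trans ?_ (killed_le_lintegral K a W a))
  exact setLIntegral_mono' (measurableSet_singleton a).compl
    fun z hz => potential_le_of_drift K a h hz

theorem lintegral_cycleMeasure (φ : S → ℝ≥0∞) :
    ∫⁻ z, φ z ∂(cycleMeasure K a) = potential K a φ a := by
  rw [cycleMeasure, lintegral_sum_measure]
  simp only [lintegral_smul_measure, lintegral_dirac, smul_eq_mul]
  have hφ : φ = fun z => ∑' y, φ y * Set.indicator {y} 1 z := by
    funext z
    rw [tsum_eq_single z fun y hy => by simp [Ne.symm hy]]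
    simp
  conv_rhs => rw [hφ, potential_tsum]
  simp only [potential_const_mul, mul_comm]

theorem cycleMeasure_univ : cycleMeasure K a Set.univ = potential K a 1 a := by
  rw [← lintegral_cycleMeasure, Pi.one_def, lintegral_one]

/-- If the expected cycle length is finite, the chain returns to `a`, and the occupation measure
of a cycle is invariant. -/
theorem invariant_cycleMeasure [IsMarkovKernel K] (h : potential K a 1 a ≠ ∞) :
    Kernel.Invariant K (cycleMeasure K a) := by
  -- The probability of returning to `a` is one, by conservation of mass.
  have hret : potential K a (fun y => K y {a}) a = 1 := by
    have h1 : (1 : S → ℝ≥0∞) = killed K a 1 + fun y => K y {a} := by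
      funext y
      have := killed_add_atom K a 1 y
      simpa using this.symm
    have h2 := potential_eq_add_potential_killed K a 1 a
    have h3 : potential K a 1 a = potential K a (killed K a 1) a
        + potential K a (fun y => K y {a}) a := by
      rw [← potential_add, ← h1]
    have h4 : potential K a (killed K a 1) a ≠ ∞ := by
      intro h5; rw [h5] at h2; exact h (by simp [h2])
    rw [h2, add_comm, Pi.one_apply] at h3
    exact ((ENNReal.add_right_inj h4).1 h3).symm
  refine Measure.ext fun s hs => ?_
  rw [Measure.bind_apply hs K.aemeasurable, lintegral_cycleMeasure,
    ← lintegral_indicator_one hs, lintegral_cycleMeasure]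
  have h1 : (fun y => K y s) = killed K a (s.indicator 1)
      + fun y => s.indicator 1 a * K y {a} := by
    funext y
    rw [Pi.add_apply, killed_add_atom, lintegral_indicator_one hs]
  rw [h1, potential_add, potential_const_mul, hret, mul_one, add_comm]
  exact (potential_eq_add_potential_killed K a (s.indicator 1) a).symm

/-- The stationary distribution as the normalized occupation measure of a cycle. -/
noncomputable def cycleProb : Measure S := (potential K a 1 a)⁻¹ • cycleMeasure K a

theorem isProbabilityMeasure_cycleProb (h : potential K a 1 a ≠ ∞) :
    IsProbabilityMeasure (cycleProb K a) := by
  refine ⟨?_⟩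
  rw [cycleProb, Measure.smul_apply, cycleMeasure_univ, smul_eq_mul]
  refine ENNReal.inv_mul_cancel ?_ h
  rw [potential_eq_add_killed_potential]
  simp

theorem invariant_cycleProb [IsMarkovKernel K] (h : potential K a 1 a ≠ ∞) :
    Kernel.Invariant K (cycleProb K a) := by
  have := invariant_cycleMeasure K a h
  refine Measure.ext fun s hs => ?_
  rw [Measure.bind_apply hs K.aemeasurable, cycleProb, lintegral_smul_measure,
    ← Measure.bind_apply hs K.aemeasurable, this.def, Measure.smul_apply]

theorem lintegral_cycleProb (φ : S → ℝ≥0∞) :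
    ∫⁻ z, φ z ∂(cycleProb K a) = (potential K a 1 a)⁻¹ * potential K a φ a := by
  rw [cycleProb, lintegral_smul_measure, lintegral_cycleMeasure, smul_eq_mul]

end Killed

/-! ### Uniqueness of stationary distributions and harmonic functions -/

section Ergodic

open scoped ENNReal

variable {S : Type*} [MeasurableSpace S] [Countable S] [MeasurableSingletonClass S]
  {K : Kernel S S} {a : S}

theorem measure_singleton_ne_zero_of_step {ν : Measure S} (hν : Kernel.Invariant K ν) {y z : S}
    (hy : ν {y} ≠ 0) (hz : K y {z} ≠ 0) : ν {z} ≠ 0 := by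
  intro h
  rw [← hν.def, Measure.bind_apply (measurableSet_singleton z) K.aemeasurable,
    lintegral_eq_zero_iff (measurable_of_countable _)] at h
  have : ν {y} = 0 := by
    refine measure_mono_null ?_ h
    rintro x rfl
    exact hz
  exact hy this

theorem measure_singleton_ne_zero_of_reach {ν : Measure S} (hν : Kernel.Invariant K ν) {y z : S}
    (hy : ν {y} ≠ 0) (hz : Relation.ReflTransGen (fun y z => K y {z} ≠ 0) y z) : ν {z} ≠ 0 := by
  induction hz with
  | refl => exact hy
  | tail _ h ih => exact measure_singleton_ne_zero_of_step hν ih h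

omit [MeasurableSingletonClass S] in
theorem exists_singleton_ne_zero {ν : Measure S} (hν : ν ≠ 0) : ∃ y, ν {y} ≠ 0 := by
  by_contra! h
  refine hν (Measure.measure_univ_eq_zero.1 ?_)
  rw [← Set.biUnion_of_singleton Set.univ]
  exact (measure_biUnion_null_iff Set.countable_univ).2 fun y _ => h y

/-- If every state leads to `a`, there is at most one stationary distribution. The minimum `κ` of
two of them is invariant, so are the two differences, and one of these does not charge `a`. -/
theorem invariant_unique [IsMarkovKernel K]
    (hreach : ∀ y, Relation.ReflTransGen (fun y z => K y {z} ≠ 0) y a)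
    {ν π : Measure S} [IsProbabilityMeasure ν] [IsProbabilityMeasure π]
    (hν : Kernel.Invariant K ν) (hπ : Kernel.Invariant K π) : ν = π := by
  have hmono : ∀ {κ θ : Measure S}, κ ≤ θ → κ.bind K ≤ θ.bind K := by
    intro κ θ h
    refine Measure.le_iff.2 fun s hs => ?_
    rw [Measure.bind_apply hs K.aemeasurable, Measure.bind_apply hs K.aemeasurable]
    exact lintegral_mono' h le_rfl
  set κ := ν ⊓ π with hκ
  have hκν : κ ≤ ν := inf_le_left
  have hκπ : κ ≤ π := inf_le_right
  have : IsFiniteMeasure κ := isFiniteMeasure_of_le ν hκν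
  have hκK : κ.bind K = κ := by
    have hle : κ.bind K ≤ κ :=
      le_inf ((hmono hκν).trans hν.def.le) ((hmono hκπ).trans hπ.def.le)
    have : IsFiniteMeasure (κ.bind K) := isFiniteMeasure_of_le κ hle
    refine Measure.eq_of_le_of_measure_univ_eq hle ?_
    rw [Measure.bind_apply MeasurableSet.univ K.aemeasurable]
    simp
  have hdiff : ∀ {θ : Measure S} [IsProbabilityMeasure θ], Kernel.Invariant K θ → κ ≤ θ →
      Kernel.Invariant K (θ - κ) := by
    intro θ _ hθ hle
    have h1 : θ - κ + κ = θ := Measure.sub_add_cancel_of_le hle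
    have h2 : (θ - κ).bind K + κ = (θ - κ) + κ := by
      rw [h1]
      conv_rhs => rw [← hθ.def, ← h1]
      refine Measure.ext fun s hs => ?_
      rw [Measure.add_apply, Measure.bind_apply hs K.aemeasurable,
        Measure.bind_apply hs K.aemeasurable, lintegral_add_measure,
        ← Measure.bind_apply hs K.aemeasurable (m := κ), hκK]
    refine Measure.ext fun s hs => ?_
    have := congrArg (fun m : Measure S => m s) h2
    simp only [Measure.add_apply] at this
    exact (ENNReal.add_left_inj (measure_ne_top κ s)).1 this
  have hone : ∀ {θ : Measure S} [IsProbabilityMeasure θ], Kernel.Invariant K θ → κ ≤ θ →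
      κ {a} = θ {a} → κ = θ := by
    intro θ _ hθ hle ha
    have h0 : (θ - κ) {a} = 0 := by
      rw [Measure.sub_apply (measurableSet_singleton a) hle, ha, tsub_self]
    by_contra hne
    have : θ - κ ≠ 0 := by
      intro h; apply hne
      have h1 : θ - κ + κ = θ := Measure.sub_add_cancel_of_le hle
      rwa [h, zero_add] at h1
    obtain ⟨y, hy⟩ := exists_singleton_ne_zero this
    exact measure_singleton_ne_zero_of_reach (hdiff hθ hle) hy (hreach y) h0
  have hmin : κ {a} = ν {a} ∨ κ {a} = π {a} := by
    have h1 : κ {a} = min (ν {a}) (π {a}) := by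
      refine le_antisymm (le_min (hκν _) (hκπ _)) ?_
      have h2 : (min (ν {a}) (π {a})) • Measure.dirac a ≤ κ := by
        refine le_inf ?_ ?_ <;> refine Measure.le_iff.2 fun s hs => ?_
        all_goals
          rw [Measure.smul_apply, Measure.dirac_apply' _ hs, smul_eq_mul]
          by_cases has : a ∈ s
          · rw [Set.indicator_of_mem has, Pi.one_apply, mul_one]
            first
            | exact (min_le_left _ _).trans (measure_mono (Set.singleton_subset_iff.2 has))
            | exact (min_le_right _ _).trans (measure_mono (Set.singleton_subset_iff.2 has))
          · simp [has]
      simpa using h2 {a}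
    rw [h1]
    exact min_choice _ _
  rcases hmin with h | h
  · have h1 : κ = ν := hone hν hκν h
    refine Measure.eq_of_le_of_measure_univ_eq (h1 ▸ hκπ) (by simp)
  · have h1 : κ = π := hone hπ hκπ h
    exact (Measure.eq_of_le_of_measure_univ_eq (h1 ▸ hκν) (by simp)).symm

omit [Countable S] [MeasurableSingletonClass S] in
theorem map_snd_compProd_of_invariant {π : Measure S} [SFinite π] [IsSFiniteKernel K]
    (hπ : Kernel.Invariant K π) : (π ⊗ₘ K).map Prod.snd = π := by
  have h := Measure.snd_compProd π K
  rwa [Measure.snd, hπ.def] at h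

omit [Countable S] [MeasurableSingletonClass S] in
theorem integrable_comp_snd_of_invariant {π : Measure S} [SFinite π] [IsSFiniteKernel K]
    (hπ : Kernel.Invariant K π) {g : S → ℝ} (hg : Integrable g π) :
    Integrable (fun p : S × S => g p.2) (π ⊗ₘ K) := by
  have hg' := hg
  rw [← map_snd_compProd_of_invariant hπ] at hg'
  exact hg'.comp_measurable measurable_snd

omit [Countable S] [MeasurableSingletonClass S] in
theorem integrable_integral_of_invariant {π : Measure S} [SFinite π] [IsSFiniteKernel K]
    (hπ : Kernel.Invariant K π) {g : S → ℝ} (hg : Integrable g π) :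
    Integrable (fun y => ∫ z, g z ∂(K y)) π := by
  have h := integrable_comp_snd_of_invariant hπ hg
  rw [Measure.compProd] at h
  simpa using h.integral_compProd

omit [Countable S] [MeasurableSingletonClass S] in
theorem integral_integral_of_invariant {π : Measure S} [SFinite π] [IsSFiniteKernel K]
    (hπ : Kernel.Invariant K π) {g : S → ℝ} (hg : Integrable g π) :
    ∫ y, ∫ z, g z ∂(K y) ∂π = ∫ y, g y ∂π := by
  have h := integrable_comp_snd_of_invariant hπ hg
  have h1 := Measure.integral_compProd h
  have h2 : ∫ z, g z ∂((π ⊗ₘ K).map Prod.snd) = ∫ p, g p.2 ∂(π ⊗ₘ K) := by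
    refine integral_map measurable_snd.aemeasurable ?_
    rw [map_snd_compProd_of_invariant hπ]
    exact hg.aestronglyMeasurable
  rw [map_snd_compProd_of_invariant hπ] at h2
  rw [h2, h1]

/-- An integrable harmonic function is almost everywhere constant, if every state leads to `a`. -/
theorem ae_eq_const_of_harmonic [IsMarkovKernel K]
    (hreach : ∀ y, Relation.ReflTransGen (fun y z => K y {z} ≠ 0) y a)
    {π : Measure S} [IsProbabilityMeasure π] (hπ : Kernel.Invariant K π) {g : S → ℝ}
    (hg : Integrable g π) (hgK : ∀ y, Integrable g (K y))
    (hharm : ∀ y, ∫ z, g z ∂(K y) = g y) : ∀ᵐ y ∂π, g y = g a := by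
  rw [ae_iff_of_countable]
  intro y hy
  -- The distance to the value `c = g y` is subharmonic and integrable, hence harmonic off a null
  -- set, so that the level set of `c` is closed under transitions.
  obtain ⟨c, hc⟩ : ∃ c, c = g y := ⟨_, rfl⟩
  have hi : Integrable (fun z => |g z - c|) π := (hg.sub (integrable_const c)).abs
  have hiP := integrable_integral_of_invariant hπ hi
  have heq := integral_integral_of_invariant hπ hi
  have hsub : ∀ x, |g x - c| ≤ ∫ z, |g z - c| ∂(K x) := by
    intro x
    have : ∫ z, (g z - c) ∂(K x) = g x - c := by
      rw [integral_sub (hgK x) (integrable_const c), hharm]; simp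
    rw [← this]
    exact abs_integral_le_integral_abs
  have hae : ∀ᵐ x ∂π, |g x - c| = ∫ z, |g z - c| ∂(K x) := by
    have h0 : ∫ x, (∫ z, |g z - c| ∂(K x) - |g x - c|) ∂π = 0 := by
      rw [integral_sub hiP hi, heq, sub_self]
    rw [integral_eq_zero_iff_of_nonneg (fun x => sub_nonneg.2 (hsub x)) (hiP.sub hi)] at h0
    filter_upwards [h0] with x hx
    exact (sub_eq_zero.1 hx).symm
  rw [ae_iff_of_countable] at hae
  have key : ∀ z, Relation.ReflTransGen (fun y z => K y {z} ≠ 0) y z → π {z} ≠ 0 ∧ g z = c := by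
    intro z hz
    induction hz with
    | refl => exact ⟨hy, hc.symm⟩
    | @tail x z _ hxz ih =>
      refine ⟨measure_singleton_ne_zero_of_step hπ ih.1 hxz, ?_⟩
      have h1 := hae x ih.1
      have hint : Integrable (fun z => |g z - c|) (K x) := ((hgK x).sub (integrable_const c)).abs
      rw [ih.2, sub_self, abs_zero, eq_comm, integral_eq_zero_iff_of_nonneg
        (fun z => abs_nonneg _) hint] at h1
      have h2 := (ae_iff_of_countable.1 h1) z hxz
      simpa [sub_eq_zero] using h2
  rw [← hc, (key a (hreach y)).2]

end Ergodic

/-! ### Foster-Lyapunov bounds and Poisson's equation -/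

section Foster

open scoped ENNReal

variable {S : Type*} [MeasurableSpace S] [Countable S] [MeasurableSingletonClass S]
  {K : Kernel S S} {a : S}

/-- The Foster-Lyapunov bound for real-valued functions: off the atom, the Lyapunov function `W`
dominates the potential of the amount `φ` by which it decreases on average. -/
theorem potential_ofReal_le {φ W : S → ℝ} (hφ : ∀ y, 0 ≤ φ y) (hW : ∀ y, 0 ≤ W y)
    (hint : ∀ y, Integrable W (K y)) (h : ∀ y, y ≠ a → φ y + ∫ z, W z ∂(K y) ≤ W y) :
    (∀ y, y ≠ a → potential K a (fun z => ENNReal.ofReal (φ z)) y ≤ ENNReal.ofReal (W y)) ∧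
      potential K a (fun z => ENNReal.ofReal (φ z)) a
        ≤ ENNReal.ofReal (φ a + ∫ z, W z ∂(K a)) := by
  have hl : ∀ y, ∫⁻ z, ENNReal.ofReal (W z) ∂(K y) = ENNReal.ofReal (∫ z, W z ∂(K y)) :=
    fun y => (ofReal_integral_eq_lintegral_ofReal (hint y) (ae_of_all _ hW)).symm
  have hd : ∀ y, y ≠ a → ENNReal.ofReal (φ y) + ∫⁻ z, ENNReal.ofReal (W z) ∂(K y)
      ≤ ENNReal.ofReal (W y) := by
    intro y hy
    rw [hl, ← ENNReal.ofReal_add (hφ y) (integral_nonneg hW)]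
    exact ENNReal.ofReal_le_ofReal (h y hy)
  refine ⟨fun y hy => potential_le_of_drift K a hd hy, ?_⟩
  refine (potential_atom_le_of_drift K a hd).trans (le_of_eq ?_)
  rw [hl, ← ENNReal.ofReal_add (hφ a) (integral_nonneg hW)]

theorem potential_ne_top_of_drift {φ W : S → ℝ} (hφ : ∀ y, 0 ≤ φ y) (hW : ∀ y, 0 ≤ W y)
    (hint : ∀ y, Integrable W (K y)) (h : ∀ y, y ≠ a → φ y + ∫ z, W z ∂(K y) ≤ W y) (y : S) :
    potential K a (fun z => ENNReal.ofReal (φ z)) y ≠ ∞ := by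
  obtain ⟨h1, h2⟩ := potential_ofReal_le hφ hW hint h
  by_cases hy : y = a
  · subst hy
    exact ne_top_of_le_ne_top ENNReal.ofReal_ne_top h2
  · exact ne_top_of_le_ne_top ENNReal.ofReal_ne_top (h1 y hy)

theorem integrable_cycleProb {φ : S → ℝ} (hφ : ∀ y, 0 ≤ φ y)
    (hfin : potential K a (fun z => ENNReal.ofReal (φ z)) a ≠ ∞) :
    Integrable φ (cycleProb K a) := by
  refine ⟨(measurable_of_countable φ).aestronglyMeasurable, ?_⟩
  rw [hasFiniteIntegral_iff_ofReal (ae_of_all _ hφ), lintegral_cycleProb]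
  refine ENNReal.mul_lt_top (ENNReal.inv_lt_top.2 ?_) hfin.lt_top
  rw [potential_eq_add_killed_potential]
  simp

theorem integral_toReal_potential [IsMarkovKernel K] {φ : S → ℝ} (hφ : ∀ y, 0 ≤ φ y)
    (hfin : ∀ y, potential K a (fun z => ENNReal.ofReal (φ z)) y ≠ ∞) (y : S) :
    Integrable (fun z => (potential K a (fun z => ENNReal.ofReal (φ z)) z).toReal) (K y) ∧
    ∫ z, (potential K a (fun z => ENNReal.ofReal (φ z)) z).toReal ∂(K y)
      = (potential K a (fun z => ENNReal.ofReal (φ z)) y).toReal - φ y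
        + (potential K a (fun z => ENNReal.ofReal (φ z)) a).toReal * (K y).real {a} := by
  set G := potential K a (fun z => ENNReal.ofReal (φ z)) with hG
  have h1 : G y = ENNReal.ofReal (φ y) + killed K a G y :=
    potential_eq_add_killed_potential K a _ y
  have hk : killed K a G y ≠ ∞ := by
    intro h; rw [h] at h1; exact hfin y (by simp [h1])
  have h2 := killed_add_atom K a G y
  have hm : G a * K y {a} ≠ ∞ := ENNReal.mul_ne_top (hfin a) (measure_ne_top _ _)
  refine ⟨integrable_toReal_of_lintegral_ne_top (measurable_of_countable _).aemeasurable ?_, ?_⟩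
  · rw [← h2]
    exact ENNReal.add_ne_top.2 ⟨hk, hm⟩
  rw [integral_toReal (measurable_of_countable _).aemeasurable
    (ae_of_all _ fun z => (hfin z).lt_top), ← h2, h1, ENNReal.toReal_add hk hm,
    ENNReal.toReal_add ENNReal.ofReal_ne_top hk, ENNReal.toReal_mul, ENNReal.toReal_ofReal (hφ y)]
  simp [Measure.real]

/-- The solution of Poisson's equation for `φ` as the expected sum of the centered `φ` over the
time before the return to the atom. -/
noncomputable def poissonPotential (K : Kernel S S) (a : S) (φ : S → ℝ) (y : S) : ℝ :=
  (potential K a (fun z => ENNReal.ofReal (φ z)) y).toReal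
    - (∫ z, φ z ∂(cycleProb K a)) * (potential K a (fun _ => ENNReal.ofReal 1) y).toReal

theorem integral_poissonPotential [IsMarkovKernel K] {φ : S → ℝ} (hφ : ∀ y, 0 ≤ φ y)
    (hfin : ∀ y, potential K a (fun z => ENNReal.ofReal (φ z)) y ≠ ∞)
    (hfin' : ∀ y, potential K a (fun _ => ENNReal.ofReal 1) y ≠ ∞) (y : S) :
    Integrable (poissonPotential K a φ) (K y) ∧
      ∫ z, poissonPotential K a φ z ∂(K y) - poissonPotential K a φ y
        = -φ y + ∫ z, φ z ∂(cycleProb K a) := by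
  obtain ⟨i1, e1⟩ := integral_toReal_potential hφ hfin y
  obtain ⟨i2, e2⟩ := integral_toReal_potential (φ := fun _ : S => (1 : ℝ))
    (fun _ => zero_le_one) hfin' y
  refine ⟨i1.sub (i2.const_mul _), ?_⟩
  have hmean : (∫ z, φ z ∂(cycleProb K a))
      * (potential K a (fun _ => ENNReal.ofReal 1) a).toReal
      = (potential K a (fun z => ENNReal.ofReal (φ z)) a).toReal := by
    rw [integral_eq_lintegral_of_nonneg_ae (ae_of_all _ hφ)
      (measurable_of_countable φ).aestronglyMeasurable, lintegral_cycleProb, ← ENNReal.toReal_mul]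
    have h1 : (1 : S → ℝ≥0∞) = fun _ => ENNReal.ofReal 1 := by simp [Pi.one_def]
    rw [h1, mul_comm, ← mul_assoc, ENNReal.mul_inv_cancel _ (hfin' a), one_mul]
    rw [potential_eq_add_killed_potential]
    simp
  simp only [poissonPotential]
  rw [integral_sub i1 (i2.const_mul _), integral_const_mul, e1, e2, ← hmean]
  ring

end Foster

/-! ### The stationary chain on path space -/

section Path

variable {ℓ : ℕ} {K : Kernel (Fin ℓ → ℕ) (Fin ℓ → ℕ)} [IsMarkovKernel K]
  {π : Measure (Fin ℓ → ℕ)} [IsProbabilityMeasure π]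

instance : IsProbabilityMeasure (chainLaw K π) := by
  unfold chainLaw
  infer_instance

/-- The Markov property. -/
theorem chainLaw_map_frestrictLe_succ (n : ℕ) :
    (chainLaw K π).map (fun Y => (Preorder.frestrictLe n Y, Y (n + 1)))
      = (chainLaw K π).map (Preorder.frestrictLe n) ⊗ₘ
        K.comap (fun x : (Π _ : Finset.Iic n, Fin ℓ → ℕ) => x ⟨n, Finset.mem_Iic.2 le_rfl⟩)
          (measurable_pi_apply _) :=
  (Kernel.map_frestrictLe_trajMeasure_compProd_eq_map_trajMeasure
    (X := fun _ => Fin ℓ → ℕ) (a := n)).symm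

omit [IsProbabilityMeasure π] in
theorem chainLaw_map_zero : (chainLaw K π).map (fun Y => Y 0) = π := by
  have h : (fun Y : ℕ → Fin ℓ → ℕ => Y 0)
      = (MeasurableEquiv.piUnique (fun _ : Finset.Iic 0 => Fin ℓ → ℕ)) ∘
        Preorder.frestrictLe (π := fun _ => Fin ℓ → ℕ) 0 := by
    funext Y
    rfl
  rw [h, ← Measure.map_map (by fun_prop) (by fun_prop), chainLaw, Kernel.trajMeasure,
    Measure.map_comp _ _ (by fun_prop), Kernel.traj_map_frestrictLe, Kernel.partialTraj_self,
    Measure.id_comp, Measure.map_map (by fun_prop) (by fun_prop)]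
  exact (congrArg (fun g => π.map g) (MeasurableEquiv.self_comp_symm _)).trans Measure.map_id

theorem chainLaw_map_pair (n : ℕ) :
    (chainLaw K π).map (fun Y => (Y n, Y (n + 1))) = (chainLaw K π).map (fun Y => Y n) ⊗ₘ K := by
  refine Measure.ext fun s hs => ?_
  have hm : Measurable fun x : (Π _ : Finset.Iic n, Fin ℓ → ℕ) =>
      x ⟨n, Finset.mem_Iic.2 le_rfl⟩ := measurable_pi_apply _
  have h1 : (fun Y : ℕ → Fin ℓ → ℕ => (Y n, Y (n + 1)))
      = Prod.map (fun x : (Π _ : Finset.Iic n, Fin ℓ → ℕ) => x ⟨n, Finset.mem_Iic.2 le_rfl⟩) id ∘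
        fun Y => (Preorder.frestrictLe n Y, Y (n + 1)) := rfl
  have h2 : (fun Y : ℕ → Fin ℓ → ℕ => Y n)
      = (fun x : (Π _ : Finset.Iic n, Fin ℓ → ℕ) => x ⟨n, Finset.mem_Iic.2 le_rfl⟩) ∘
        Preorder.frestrictLe (π := fun _ => Fin ℓ → ℕ) n := rfl
  have hp : Measurable (Prod.map (fun x : (Π _ : Finset.Iic n, Fin ℓ → ℕ) =>
      x ⟨n, Finset.mem_Iic.2 le_rfl⟩) (id : (Fin ℓ → ℕ) → _)) := hm.prodMap measurable_id
  rw [h1, ← Measure.map_map hp (by fun_prop), chainLaw_map_frestrictLe_succ, h2,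
    ← Measure.map_map hm (by fun_prop), Measure.map_apply hp hs,
    Measure.compProd_apply (hp hs), Measure.compProd_apply hs,
    lintegral_map (measurable_of_countable _) hm]
  rfl

theorem chainLaw_map (hπ : Kernel.Invariant K π) (n : ℕ) :
    (chainLaw K π).map (fun Y => Y n) = π := by
  induction n with
  | zero => exact chainLaw_map_zero
  | succ n ih =>
    have h : (fun Y : ℕ → Fin ℓ → ℕ => Y (n + 1)) = Prod.snd ∘ fun Y => (Y n, Y (n + 1)) := rfl
    rw [h, ← Measure.map_map measurable_snd (by fun_prop), chainLaw_map_pair, ih,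
      map_snd_compProd_of_invariant hπ]

theorem chainLaw_map_pair_of_invariant (hπ : Kernel.Invariant K π) (n : ℕ) :
    (chainLaw K π).map (fun Y => (Y n, Y (n + 1))) = π ⊗ₘ K := by
  rw [chainLaw_map_pair, chainLaw_map hπ]

/-- A square integrable increment of conditional mean zero is orthogonal to the past. -/
theorem integral_past_mul_eq_zero (hπ : Kernel.Invariant K π)
    {n : ℕ} {Φ : (Π _ : Finset.Iic n, Fin ℓ → ℕ) → ℝ} (hΦm : Measurable Φ)
    (hΦ : MemLp (fun Y => Φ (Preorder.frestrictLe n Y)) 2 (chainLaw K π))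
    {D : (Fin ℓ → ℕ) × (Fin ℓ → ℕ) → ℝ} (hD : MemLp D 2 (π ⊗ₘ K))
    (hD0 : ∀ y, ∫ z, D (y, z) ∂(K y) = 0) :
    ∫ Y, Φ (Preorder.frestrictLe n Y) * D (Y n, Y (n + 1)) ∂(chainLaw K π) = 0 := by
  have hDm : Measurable D := measurable_of_countable _
  have hD' : MemLp (fun Y : ℕ → Fin ℓ → ℕ => D (Y n, Y (n + 1))) 2 (chainLaw K π) := by
    rw [← chainLaw_map_pair_of_invariant hπ n] at hD
    exact hD.comp_of_map (by fun_prop)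
  have hint : Integrable (fun Y : ℕ → Fin ℓ → ℕ =>
      Φ (Preorder.frestrictLe n Y) * D (Y n, Y (n + 1))) (chainLaw K π) := hΦ.integrable_mul hD'
  set F : (Π _ : Finset.Iic n, Fin ℓ → ℕ) × (Fin ℓ → ℕ) → ℝ :=
    fun p => Φ p.1 * D (p.1 ⟨n, Finset.mem_Iic.2 le_rfl⟩, p.2) with hF
  have hFm : Measurable F := by fun_prop
  have h1 : ∫ Y, Φ (Preorder.frestrictLe n Y) * D (Y n, Y (n + 1)) ∂(chainLaw K π)
      = ∫ p, F p ∂((chainLaw K π).map fun Y => (Preorder.frestrictLe n Y, Y (n + 1))) :=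
    (integral_map (φ := fun Y : ℕ → Fin ℓ → ℕ => (Preorder.frestrictLe n Y, Y (n + 1)))
      (Measurable.aemeasurable (by fun_prop)) hFm.aestronglyMeasurable).symm
  have h2 : Integrable F
      ((chainLaw K π).map fun Y => (Preorder.frestrictLe n Y, Y (n + 1))) :=
    (integrable_map_measure hFm.aestronglyMeasurable
      (Measurable.aemeasurable (by fun_prop))).2 hint
  rw [h1]
  rw [chainLaw_map_frestrictLe_succ] at h2 ⊢
  rw [Measure.integral_compProd h2]
  simp only [hF, Kernel.comap_apply, integral_const_mul, hD0, mul_zero, integral_zero]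

end Path

/-! ### Martingale representation of time-average covariances -/

section Variance

variable {ℓ : ℕ} {K : Kernel (Fin ℓ → ℕ) (Fin ℓ → ℕ)} [IsMarkovKernel K]
  {π : Measure (Fin ℓ → ℕ)} [IsProbabilityMeasure π]

/-- The increment, over a transition from `p.1` to `p.2`, of the martingale attached to the
solution `h` of Poisson's equation for `g`. -/
noncomputable def poissonIncrement (π : Measure (Fin ℓ → ℕ)) (g h : (Fin ℓ → ℕ) → ℝ)
    (p : (Fin ℓ → ℕ) × (Fin ℓ → ℕ)) : ℝ :=
  h p.2 - h p.1 + (g p.1 - ∫ z, g z ∂π)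

/-- `h` is a square integrable solution of Poisson's equation for the square integrable `g`. -/
structure IsL2PoissonSolution (K : Kernel (Fin ℓ → ℕ) (Fin ℓ → ℕ)) (π : Measure (Fin ℓ → ℕ))
    (g h : (Fin ℓ → ℕ) → ℝ) : Prop where
  memLp_function : MemLp g 2 π
  memLp_solution : MemLp h 2 π
  integrable_step : ∀ y, Integrable h (K y)
  poisson : ∀ y, drift K h y = -g y + ∫ z, g z ∂π

theorem memLp_comp_coord (hπ : Kernel.Invariant K π) {g : (Fin ℓ → ℕ) → ℝ} (hg : MemLp g 2 π)
    (n : ℕ) : MemLp (fun Y => g (Y n)) 2 (chainLaw K π) := by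
  rw [← chainLaw_map hπ n] at hg
  exact hg.comp_of_map (Measurable.aemeasurable (by fun_prop))

theorem integral_comp_coord (hπ : Kernel.Invariant K π) (g : (Fin ℓ → ℕ) → ℝ) (n : ℕ) :
    ∫ Y, g (Y n) ∂(chainLaw K π) = ∫ y, g y ∂π := by
  conv_rhs => rw [← chainLaw_map hπ n]
  exact (integral_map (φ := fun Y : ℕ → Fin ℓ → ℕ => Y n) (Measurable.aemeasurable (by fun_prop))
    (measurable_of_countable g).aestronglyMeasurable).symm

theorem memLp_poissonIncrement (hπ : Kernel.Invariant K π) {g h : (Fin ℓ → ℕ) → ℝ}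
    (H : IsL2PoissonSolution K π g h) : MemLp (poissonIncrement π g h) 2 (π ⊗ₘ K) := by
  have hfst : ∀ {φ : (Fin ℓ → ℕ) → ℝ}, MemLp φ 2 π →
      MemLp (fun p : (Fin ℓ → ℕ) × (Fin ℓ → ℕ) => φ p.1) 2 (π ⊗ₘ K) := by
    intro φ hφ
    have h1 : (π ⊗ₘ K).map Prod.fst = π := Measure.fst_compProd π K
    rw [← h1] at hφ
    exact hφ.comp_of_map measurable_fst.aemeasurable
  have hsnd : ∀ {φ : (Fin ℓ → ℕ) → ℝ}, MemLp φ 2 π →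
      MemLp (fun p : (Fin ℓ → ℕ) × (Fin ℓ → ℕ) => φ p.2) 2 (π ⊗ₘ K) := by
    intro φ hφ
    rw [← map_snd_compProd_of_invariant hπ] at hφ
    exact hφ.comp_of_map measurable_snd.aemeasurable
  exact ((hsnd H.memLp_solution).sub (hfst H.memLp_solution)).add
    ((hfst H.memLp_function).sub (memLp_const _))

omit [IsProbabilityMeasure π] in
theorem integral_poissonIncrement {g h : (Fin ℓ → ℕ) → ℝ}
    (H : IsL2PoissonSolution K π g h) (y : Fin ℓ → ℕ) :
    ∫ z, poissonIncrement π g h (y, z) ∂(K y) = 0 := by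
  have h1 := H.poisson y
  have h2 := H.integrable_step y
  simp only [poissonIncrement, drift] at h1 ⊢
  have h3 : Integrable (fun z => h z - h y) (K y) := h2.sub (integrable_const _)
  rw [integral_add h3 (integrable_const _), integral_sub h2 (integrable_const _)]
  simp only [integral_const, probReal_univ, one_smul]
  linarith

/-- The martingale attached to `g` and `h`, at time `n`. -/
noncomputable def poissonMartingale (π : Measure (Fin ℓ → ℕ)) (g h : (Fin ℓ → ℕ) → ℝ) (n : ℕ)
    (Y : ℕ → Fin ℓ → ℕ) : ℝ :=
  ∑ k ∈ Finset.range n, poissonIncrement π g h (Y k, Y (k + 1))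

omit [IsProbabilityMeasure π] in
theorem sum_centered_eq (g h : (Fin ℓ → ℕ) → ℝ) (n : ℕ) (Y : ℕ → Fin ℓ → ℕ) :
    ∑ k ∈ Finset.range n, (g (Y k) - ∫ z, g z ∂π)
      = (h (Y 0) - h (Y n)) + poissonMartingale π g h n Y := by
  simp only [poissonMartingale, poissonIncrement, Finset.sum_add_distrib]
  rw [Finset.sum_range_sub (fun k => h (Y k))]
  ring

theorem memLp_comp_pair (hπ : Kernel.Invariant K π) {D : (Fin ℓ → ℕ) × (Fin ℓ → ℕ) → ℝ}
    (hD : MemLp D 2 (π ⊗ₘ K)) (n : ℕ) :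
    MemLp (fun Y : ℕ → Fin ℓ → ℕ => D (Y n, Y (n + 1))) 2 (chainLaw K π) := by
  rw [← chainLaw_map_pair_of_invariant hπ n] at hD
  exact hD.comp_of_map (Measurable.aemeasurable (by fun_prop))

theorem memLp_poissonMartingale (hπ : Kernel.Invariant K π) {g h : (Fin ℓ → ℕ) → ℝ}
    (H : IsL2PoissonSolution K π g h) (n : ℕ) :
    MemLp (poissonMartingale π g h n) 2 (chainLaw K π) :=
  memLp_finsetSum _ fun k _ => memLp_comp_pair hπ (memLp_poissonIncrement hπ H) k

theorem integral_martingale_mul_increment (hπ : Kernel.Invariant K π)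
    {g₁ h₁ g₂ h₂ : (Fin ℓ → ℕ) → ℝ} (H₁ : IsL2PoissonSolution K π g₁ h₁)
    (H₂ : IsL2PoissonSolution K π g₂ h₂) (n : ℕ) :
    ∫ Y, poissonMartingale π g₁ h₁ n Y * poissonIncrement π g₂ h₂ (Y n, Y (n + 1))
      ∂(chainLaw K π) = 0 := by
  -- The martingale at time `n` as a function of the path up to time `n`.
  set Φ : (Π _ : Finset.Iic n, Fin ℓ → ℕ) → ℝ := fun x =>
    poissonMartingale π g₁ h₁ n fun k => x ⟨min k n, Finset.mem_Iic.2 (min_le_right k n)⟩ with hΦ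
  have hΦm : Measurable Φ := by
    refine Finset.measurable_sum _ fun k _ => ?_
    exact (measurable_of_countable (poissonIncrement π g₁ h₁)).comp
      ((measurable_pi_apply _).prodMk (measurable_pi_apply _))
  have hΦeq : ∀ Y : ℕ → Fin ℓ → ℕ, Φ (Preorder.frestrictLe n Y)
      = poissonMartingale π g₁ h₁ n Y := by
    intro Y
    refine Finset.sum_congr rfl fun k hk => ?_
    have hk' := Finset.mem_range.1 hk
    have e1 : min k n = k := min_eq_left hk'.le
    have e2 : min (k + 1) n = k + 1 := min_eq_left hk'
    simp only [Preorder.frestrictLe_apply, e1, e2]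
  have := integral_past_mul_eq_zero hπ hΦm
    (by simpa only [hΦeq] using memLp_poissonMartingale hπ H₁ n)
    (memLp_poissonIncrement hπ H₂) (integral_poissonIncrement H₂)
  simpa only [hΦeq] using this

theorem integral_add_four {Ω : Type*} [MeasurableSpace Ω] {μ : Measure Ω} {u v w x : Ω → ℝ}
    (hu : Integrable u μ) (hv : Integrable v μ) (hw : Integrable w μ) (hx : Integrable x μ) :
    ∫ t, (u t + v t + w t + x t) ∂μ
      = ∫ t, u t ∂μ + ∫ t, v t ∂μ + ∫ t, w t ∂μ + ∫ t, x t ∂μ := by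
  have h1 : Integrable (fun t => u t + v t) μ := hu.add hv
  have h2 : Integrable (fun t => u t + v t + w t) μ := h1.add hw
  rw [integral_add h2 hx, integral_add h1 hw, integral_add hu hv]

/-- Orthogonality of the increments. -/
theorem integral_martingale_mul_martingale (hπ : Kernel.Invariant K π)
    {g₁ h₁ g₂ h₂ : (Fin ℓ → ℕ) → ℝ} (H₁ : IsL2PoissonSolution K π g₁ h₁)
    (H₂ : IsL2PoissonSolution K π g₂ h₂) (n : ℕ) :
    ∫ Y, poissonMartingale π g₁ h₁ n Y * poissonMartingale π g₂ h₂ n Y ∂(chainLaw K π)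
      = n * ∫ p, poissonIncrement π g₁ h₁ p * poissonIncrement π g₂ h₂ p ∂(π ⊗ₘ K) := by
  induction n with
  | zero => simp [poissonMartingale]
  | succ n ih =>
    have m1 := memLp_poissonMartingale hπ H₁ n
    have m2 := memLp_poissonMartingale hπ H₂ n
    have d1 := memLp_comp_pair hπ (memLp_poissonIncrement hπ H₁) n
    have d2 := memLp_comp_pair hπ (memLp_poissonIncrement hπ H₂) n
    have hs : ∀ Y : ℕ → Fin ℓ → ℕ,
        poissonMartingale π g₁ h₁ (n + 1) Y * poissonMartingale π g₂ h₂ (n + 1) Y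
        = poissonMartingale π g₁ h₁ n Y * poissonMartingale π g₂ h₂ n Y
          + poissonMartingale π g₁ h₁ n Y * poissonIncrement π g₂ h₂ (Y n, Y (n + 1))
          + poissonMartingale π g₂ h₂ n Y * poissonIncrement π g₁ h₁ (Y n, Y (n + 1))
          + poissonIncrement π g₁ h₁ (Y n, Y (n + 1))
            * poissonIncrement π g₂ h₂ (Y n, Y (n + 1)) := by
      intro Y
      simp only [poissonMartingale, Finset.sum_range_succ]
      ring
    have hd : ∫ Y : ℕ → Fin ℓ → ℕ, poissonIncrement π g₁ h₁ (Y n, Y (n + 1))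
            * poissonIncrement π g₂ h₂ (Y n, Y (n + 1)) ∂(chainLaw K π)
        = ∫ p, poissonIncrement π g₁ h₁ p * poissonIncrement π g₂ h₂ p ∂(π ⊗ₘ K) := by
      rw [← chainLaw_map_pair_of_invariant hπ n]
      exact (integral_map (φ := fun Y : ℕ → Fin ℓ → ℕ => (Y n, Y (n + 1)))
        (f := fun p => poissonIncrement π g₁ h₁ p * poissonIncrement π g₂ h₂ p)
        (Measurable.aemeasurable (by fun_prop))
        (measurable_of_countable _).aestronglyMeasurable).symm
    have i1 := m1.integrable_mul m2
    have i2 := m1.integrable_mul d2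
    have i3 := m2.integrable_mul d1
    have i4 := d1.integrable_mul d2
    simp only [hs]
    refine (integral_add_four i1 i2 i3 i4).trans ?_
    simp only [Pi.mul_apply]
    rw [ih, integral_martingale_mul_increment hπ H₁ H₂, integral_martingale_mul_increment hπ H₂ H₁, hd]
    push_cast
    ring

theorem integral_boundary_sq_le (hπ : Kernel.Invariant K π) {h : (Fin ℓ → ℕ) → ℝ}
    (hh : MemLp h 2 π) (n : ℕ) :
    ∫ Y, (h (Y 0) - h (Y n)) ^ 2 ∂(chainLaw K π) ≤ 4 * ∫ y, h y ^ 2 ∂π := by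
  have m0 := memLp_comp_coord hπ hh 0
  have mn := memLp_comp_coord hπ hh n
  calc ∫ Y, (h (Y 0) - h (Y n)) ^ 2 ∂(chainLaw K π)
      ≤ ∫ Y, (2 * h (Y 0) ^ 2 + 2 * h (Y n) ^ 2) ∂(chainLaw K π) := by
        refine integral_mono (m0.sub mn).integrable_sq
          ((m0.integrable_sq.const_mul 2).add (mn.integrable_sq.const_mul 2)) fun Y => ?_
        dsimp only
        nlinarith [sq_nonneg (h (Y 0) + h (Y n))]
    _ = 4 * ∫ y, h y ^ 2 ∂π := by
        rw [integral_add (m0.integrable_sq.const_mul 2) (mn.integrable_sq.const_mul 2),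
          integral_const_mul, integral_const_mul,
          integral_comp_coord hπ (fun y => h y ^ 2), integral_comp_coord hπ (fun y => h y ^ 2)]
        ring

/-- A weighted form of the inequality between the arithmetic and the geometric mean. -/
theorem abs_integral_mul_le {Ω : Type*} [MeasurableSpace Ω] {μ : Measure Ω} {U M : Ω → ℝ}
    (hU : MemLp U 2 μ) (hM : MemLp M 2 μ) {t : ℝ} (ht : 0 < t) :
    |∫ x, U x * M x ∂μ| ≤ (t * ∫ x, U x ^ 2 ∂μ + t⁻¹ * ∫ x, M x ^ 2 ∂μ) / 2 := by
  have i1 := hU.integrable_sq.const_mul t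
  have i2 := hM.integrable_sq.const_mul t⁻¹
  rw [← integral_const_mul, ← integral_const_mul, ← integral_add i1 i2, ← integral_div]
  refine abs_integral_le_integral_abs.trans ?_
  refine integral_mono (hU.integrable_mul hM).abs ((i1.add i2).div_const 2) fun x => ?_
  dsimp only
  have h : (t * U x ^ 2 + t⁻¹ * M x ^ 2) / 2 - |U x * M x|
      = t⁻¹ / 2 * (t * |U x| - |M x|) ^ 2 := by
    rw [abs_mul, ← sq_abs (U x), ← sq_abs (M x)]
    field_simp
    ring
  have : 0 ≤ t⁻¹ / 2 * (t * |U x| - |M x|) ^ 2 := by positivity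
  linarith

/-- The time-average covariance of two functions with square integrable solutions of Poisson's
equation is the stationary covariance of the increments of the associated martingales. -/
theorem tendsto_covariance_mean (hπ : Kernel.Invariant K π)
    {g₁ h₁ g₂ h₂ : (Fin ℓ → ℕ) → ℝ} (H₁ : IsL2PoissonSolution K π g₁ h₁)
    (H₂ : IsL2PoissonSolution K π g₂ h₂) :
    Tendsto (fun n : ℕ => (n : ℝ) *
      cov[fun Y => (n : ℝ)⁻¹ * ∑ k ∈ Finset.range n, g₁ (Y k),
        fun Y => (n : ℝ)⁻¹ * ∑ k ∈ Finset.range n, g₂ (Y k); chainLaw K π]) atTop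
      (𝓝 (∫ p, poissonIncrement π g₁ h₁ p * poissonIncrement π g₂ h₂ p ∂(π ⊗ₘ K))) := by
  set c := ∫ p, poissonIncrement π g₁ h₁ p * poissonIncrement π g₂ h₂ p ∂(π ⊗ₘ K) with hc
  set c₁ := ∫ p, poissonIncrement π g₁ h₁ p * poissonIncrement π g₁ h₁ p ∂(π ⊗ₘ K) with hc₁
  set c₂ := ∫ p, poissonIncrement π g₂ h₂ p * poissonIncrement π g₂ h₂ p ∂(π ⊗ₘ K) with hc₂
  set a₁ := ∫ y, h₁ y ^ 2 ∂π with ha₁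
  set a₂ := ∫ y, h₂ y ^ 2 ∂π with ha₂
  have ha₁0 : 0 ≤ a₁ := integral_nonneg fun _ => sq_nonneg _
  have ha₂0 : 0 ≤ a₂ := integral_nonneg fun _ => sq_nonneg _
  set B := 2 * (a₁ + a₂) + (4 * a₁ + c₂) / 2 + (4 * a₂ + c₁) / 2 with hB
  have hsum : ∀ {g h : (Fin ℓ → ℕ) → ℝ}, IsL2PoissonSolution K π g h → ∀ n : ℕ,
      ∀ Y, ∑ k ∈ Finset.range n, g (Y k) - ∫ Y, ∑ k ∈ Finset.range n, g (Y k) ∂(chainLaw K π)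
        = (h (Y 0) - h (Y n)) + poissonMartingale π g h n Y := by
    intro g h H n Y
    rw [← sum_centered_eq, integral_finsetSum _ fun k _ =>
      (memLp_comp_coord hπ H.memLp_function k).integrable one_le_two]
    simp only [integral_comp_coord hπ, Finset.sum_sub_distrib]
  have hcov : ∀ n : ℕ, 0 < n → |(n : ℝ) *
      cov[fun Y => (n : ℝ)⁻¹ * ∑ k ∈ Finset.range n, g₁ (Y k),
        fun Y => (n : ℝ)⁻¹ * ∑ k ∈ Finset.range n, g₂ (Y k); chainLaw K π] - c|
      ≤ B * (√n)⁻¹ := by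
    intro n hn
    have hn' : (0 : ℝ) < n := Nat.cast_pos.2 hn
    have hs : (0 : ℝ) < √n := Real.sqrt_pos.2 hn'
    have hs1 : (1 : ℝ) ≤ √n := Real.one_le_sqrt.2 (by exact_mod_cast hn)
    have u1 := (memLp_comp_coord hπ H₁.memLp_solution 0).sub
      (memLp_comp_coord hπ H₁.memLp_solution n)
    have u2 := (memLp_comp_coord hπ H₂.memLp_solution 0).sub
      (memLp_comp_coord hπ H₂.memLp_solution n)
    have m1 := memLp_poissonMartingale hπ H₁ n
    have m2 := memLp_poissonMartingale hπ H₂ n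
    have b1 := integral_boundary_sq_le hπ H₁.memLp_solution n
    have b2 := integral_boundary_sq_le hπ H₂.memLp_solution n
    have e11 : ∫ Y, poissonMartingale π g₁ h₁ n Y ^ 2 ∂(chainLaw K π) = n * c₁ := by
      simp only [sq]; exact integral_martingale_mul_martingale hπ H₁ H₁ n
    have e22 : ∫ Y, poissonMartingale π g₂ h₂ n Y ^ 2 ∂(chainLaw K π) = n * c₂ := by
      simp only [sq]; exact integral_martingale_mul_martingale hπ H₂ H₂ n
    have p1 := abs_integral_mul_le u1 u2 one_pos
    have p2 := abs_integral_mul_le u1 m2 hs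
    have p3 := abs_integral_mul_le u2 m1 hs
    simp only [Pi.sub_apply] at p1 p2 p3
    have hE : cov[fun Y => ∑ k ∈ Finset.range n, g₁ (Y k),
        fun Y => ∑ k ∈ Finset.range n, g₂ (Y k); chainLaw K π]
        = ∫ Y, (h₁ (Y 0) - h₁ (Y n)) * (h₂ (Y 0) - h₂ (Y n)) ∂(chainLaw K π)
          + ∫ Y, (h₁ (Y 0) - h₁ (Y n)) * poissonMartingale π g₂ h₂ n Y ∂(chainLaw K π)
          + ∫ Y, (h₂ (Y 0) - h₂ (Y n)) * poissonMartingale π g₁ h₁ n Y ∂(chainLaw K π)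
          + n * c := by
      rw [covariance, hc, ← integral_martingale_mul_martingale hπ H₁ H₂ n]
      simp only [hsum H₁, hsum H₂]
      refine Eq.trans ?_ (integral_add_four (u1.integrable_mul u2) (u1.integrable_mul m2)
        (u2.integrable_mul m1) (m1.integrable_mul m2))
      refine integral_congr_ae (ae_of_all _ fun Y => ?_)
      ring
    rw [covariance_const_mul_left, covariance_const_mul_right, hE]
    rw [e22] at p2
    rw [e11] at p3
    have hinv : (√n)⁻¹ * (n : ℝ) = √n := by
      rw [inv_mul_eq_div, Real.div_sqrt]
    rw [← mul_assoc, hinv] at p2 p3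
    set I₁ := ∫ Y, (h₁ (Y 0) - h₁ (Y n)) * (h₂ (Y 0) - h₂ (Y n)) ∂(chainLaw K π)
    set I₂ := ∫ Y, (h₁ (Y 0) - h₁ (Y n)) * poissonMartingale π g₂ h₂ n Y ∂(chainLaw K π)
    set I₃ := ∫ Y, (h₂ (Y 0) - h₂ (Y n)) * poissonMartingale π g₁ h₁ n Y ∂(chainLaw K π)
    have hrw : (n : ℝ) * ((n : ℝ)⁻¹ * ((n : ℝ)⁻¹ * (I₁ + I₂ + I₃ + n * c))) - c
        = (n : ℝ)⁻¹ * (I₁ + I₂ + I₃) := by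
      field_simp
      ring
    rw [hrw, abs_mul, abs_of_pos (inv_pos.2 hn')]
    have htot : |I₁ + I₂ + I₃| ≤ B * √n := by
      have t1 : |I₁| ≤ 2 * (a₁ + a₂) * √n := by
        have : |I₁| ≤ 2 * (a₁ + a₂) := by linarith
        nlinarith
      have t2 : |I₂| ≤ (4 * a₁ + c₂) / 2 * √n := by nlinarith
      have t3 : |I₃| ≤ (4 * a₂ + c₁) / 2 * √n := by nlinarith
      have := abs_add_three I₁ I₂ I₃
      rw [hB]
      linarith
    calc (n : ℝ)⁻¹ * |I₁ + I₂ + I₃| ≤ (n : ℝ)⁻¹ * (B * √n) := by gcongr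
      _ = B * (√n)⁻¹ := by
        nth_rewrite 1 [← Real.mul_self_sqrt hn'.le]
        field_simp
  have hlim : Tendsto (fun n : ℕ => B * (√(n : ℝ))⁻¹) atTop (𝓝 0) := by
    have := (tendsto_inv_atTop_zero.comp
      (Real.tendsto_sqrt_atTop.comp tendsto_natCast_atTop_atTop)).const_mul B
    simpa using this
  rw [tendsto_iff_norm_sub_tendsto_zero]
  refine squeeze_zero' (Eventually.of_forall fun _ => norm_nonneg _) ?_ hlim
  filter_upwards [eventually_gt_atTop 0] with n hn
  exact hcov n hn

theorem tendsto_variance_mean (hπ : Kernel.Invariant K π)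
    {g h : (Fin ℓ → ℕ) → ℝ} (H : IsL2PoissonSolution K π g h) :
    Tendsto (fun n : ℕ => (n : ℝ) *
      Var[fun Y => (n : ℝ)⁻¹ * ∑ k ∈ Finset.range n, g (Y k); chainLaw K π]) atTop
      (𝓝 (∫ p, poissonIncrement π g h p ^ 2 ∂(π ⊗ₘ K))) := by
  have h1 := tendsto_covariance_mean hπ H H
  simp only [sq]
  refine h1.congr fun n => ?_
  rw [covariance_self]
  exact (Finset.measurable_sum _ fun k _ => (measurable_of_countable g).comp
    (measurable_pi_apply k)).const_mul _ |>.aemeasurable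

end Variance

/-! ### Workload vector and transition kernel -/

namespace Station

variable {ℓ : ℕ} (N : Station ℓ)

/-- The solution `x = (1 - R)⁻¹ v` of `x = v + R x`: the expected total of `v` over the classes
that a customer visits before leaving. -/
noncomputable def visitSum (v : Fin ℓ → ℝ) : Fin ℓ → ℝ := (1 - N.routing)⁻¹ *ᵥ v

theorem isUnit_det_one_sub_routing : IsUnit (1 - N.routing).det := by
  rw [← Matrix.isUnit_iff_isUnit_det]
  exact ⟨⟨1 - N.routing, ∑' k, N.routing ^ k, N.transient.one_sub_mul_tsum_pow,
    N.transient.tsum_pow_mul_one_sub⟩, rfl⟩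

theorem inv_one_sub_routing : (1 - N.routing)⁻¹ = ∑' k, N.routing ^ k :=
  Matrix.inv_eq_left_inv N.transient.tsum_pow_mul_one_sub

theorem inv_one_sub_routing_nonneg (i j : Fin ℓ) : 0 ≤ (1 - N.routing)⁻¹ i j := by
  have hpow : ∀ k : ℕ, ∀ i j, 0 ≤ (N.routing ^ k) i j := by
    intro k
    induction k with
    | zero =>
      intro i j
      rw [pow_zero, Matrix.one_apply]
      split_ifs <;> norm_num
    | succ k ih =>
      intro i j
      rw [pow_succ, Matrix.mul_apply]
      exact Finset.sum_nonneg fun l _ => mul_nonneg (ih i l) (N.routing_nonneg l j)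
  rw [inv_one_sub_routing]
  have h1 : HasSum (fun k => (N.routing ^ k) i j) ((∑' k, N.routing ^ k) i j) :=
    Pi.hasSum.1 (Pi.hasSum.1 N.transient.hasSum i) j
  exact h1.nonneg fun k => hpow k i j

theorem visitSum_eq (v : Fin ℓ → ℝ) (i : Fin ℓ) :
    N.visitSum v i - ∑ j, N.routing i j * N.visitSum v j = v i := by
  have h : (1 - N.routing) *ᵥ N.visitSum v = v := by
    rw [visitSum, Matrix.mulVec_mulVec, Matrix.mul_nonsing_inv _ N.isUnit_det_one_sub_routing,
      Matrix.one_mulVec]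
  have h1 := congrFun h i
  rw [Matrix.sub_mulVec, Matrix.one_mulVec] at h1
  exact h1

theorem visitSum_nonneg {v : Fin ℓ → ℝ} (hv : ∀ i, 0 ≤ v i) (i : Fin ℓ) :
    0 ≤ N.visitSum v i := by
  rw [visitSum, Matrix.mulVec, dotProduct]
  exact Finset.sum_nonneg fun j _ => mul_nonneg (N.inv_one_sub_routing_nonneg i j) (hv j)

theorem le_visitSum {v : Fin ℓ → ℝ} (hv : ∀ i, 0 ≤ v i) (i : Fin ℓ) : v i ≤ N.visitSum v i := by
  have h1 := N.visitSum_eq v i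
  have h2 : 0 ≤ ∑ j, N.routing i j * N.visitSum v j :=
    Finset.sum_nonneg fun j _ => mul_nonneg (N.routing_nonneg i j) (N.visitSum_nonneg hv j)
  linarith

theorem inv_diagonal_service :
    (Matrix.diagonal N.service)⁻¹ = Matrix.diagonal fun i => (N.service i)⁻¹ := by
  refine Matrix.inv_eq_left_inv ?_
  rw [Matrix.diagonal_mul_diagonal, ← Matrix.diagonal_one]
  congr 1
  funext i
  exact inv_mul_cancel₀ (N.service_pos i).ne'

/-- The workload of a class-`i` customer is the mean total service time it still requires. -/
theorem d_eq_visitSum : N.d = N.visitSum fun i => (N.service i)⁻¹ := by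
  have h : (1 - N.routingᵀ)⁻¹ = ((1 - N.routing)⁻¹)ᵀ := by
    rw [← Matrix.transpose_one, ← Matrix.transpose_sub, Matrix.transpose_nonsing_inv]
    simp
  rw [d, Q, ← Matrix.vecMul_vecMul, h, Matrix.vecMul_transpose, visitSum, inv_diagonal_service]
  congr 1
  funext i
  simp [Matrix.vecMul_diagonal]

theorem d_sub (i : Fin ℓ) : N.d i - ∑ j, N.routing i j * N.d j = (N.service i)⁻¹ := by
  rw [d_eq_visitSum]
  exact N.visitSum_eq _ i

theorem d_pos (i : Fin ℓ) : 0 < N.d i := by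
  rw [d_eq_visitSum]
  exact (inv_pos.2 (N.service_pos i)).trans_le
    (N.le_visitSum (fun i => (inv_pos.2 (N.service_pos i)).le) i)

theorem d_dotProduct_arrival (hload : ∑ i, (N.Q *ᵥ N.arrival) i = 1) :
    ∑ i, N.arrival i * N.d i = 1 := by
  rw [← hload, d]
  have : ∑ i, N.arrival i * ((1 : Fin ℓ → ℝ) ᵥ* N.Q) i
      = ((1 : Fin ℓ → ℝ) ᵥ* N.Q) ⬝ᵥ N.arrival := by
    simp only [dotProduct, mul_comm]
  rw [this, ← Matrix.dotProduct_mulVec, one_dotProduct]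

theorem service_le_one (i : Fin ℓ) : N.service i ≤ 1 := by
  rw [← N.time_scale]
  refine le_trans ?_ (Finset.single_le_sum (f := fun i => N.arrival i + N.service i)
    (fun j _ => add_nonneg (N.arrival_nonneg j) (N.service_pos j).le) (Finset.mem_univ i))
  simpa using N.arrival_nonneg i

theorem nonempty_class (N : Station ℓ) : Nonempty (Fin ℓ) := by
  by_contra h
  rw [not_nonempty_iff] at h
  have := N.time_scale
  simp at this

section Step

variable (ρ : Set.Ioo (0 : ℝ) 1) (w : NonIdlingPolicy ℓ)

theorem arrivalRate_nonneg (i : Fin ℓ) : 0 ≤ (ρ : ℝ) * N.arrival i :=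
  mul_nonneg ρ.2.1.le (N.arrival_nonneg i)

theorem routeRate_nonneg (y : Fin ℓ → ℕ) (i j : Fin ℓ) :
    0 ≤ N.service i * w.alloc y i * N.routing i j :=
  mul_nonneg (mul_nonneg (N.service_pos i).le (w.alloc_nonneg y i)) (N.routing_nonneg i j)

theorem exitRate_nonneg (y : Fin ℓ → ℕ) (i : Fin ℓ) :
    0 ≤ N.service i * w.alloc y i * (1 - ∑ j, N.routing i j) :=
  mul_nonneg (mul_nonneg (N.service_pos i).le (w.alloc_nonneg y i))
    (sub_nonneg.2 (N.routing_row_le_one i))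

theorem idleRate_nonneg (y : Fin ℓ → ℕ) :
    0 ≤ 1 - ∑ i, (ρ : ℝ) * N.arrival i - ∑ i, N.service i * w.alloc y i := by
  have hle : ∑ i, (ρ : ℝ) * N.arrival i + ∑ i, N.service i * w.alloc y i ≤ 1 := by
    refine le_trans ?_ N.time_scale.le
    rw [← Finset.sum_add_distrib]
    refine Finset.sum_le_sum fun i _ => add_le_add ?_ ?_
    · exact mul_le_of_le_one_left (N.arrival_nonneg i) ρ.2.2.le
    · exact mul_le_of_le_one_right (N.service_pos i).le (alloc_le_one w y i)
  linarith

theorem integrable_kernel (ψ : (Fin ℓ → ℕ) → ℝ) (y : Fin ℓ → ℕ) :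
    Integrable ψ (N.kernel ρ w y) := by
  have hd : ∀ z : Fin ℓ → ℕ, Integrable ψ (Measure.dirac z) := fun z =>
    integrable_dirac (by simp)
  have hs : ∀ (r : ℝ) (z : Fin ℓ → ℕ),
      Integrable ψ (ENNReal.ofReal r • Measure.dirac z) :=
    fun r z => (hd z).smul_measure ENNReal.ofReal_ne_top
  change Integrable ψ (N.step ρ w y)
  unfold step
  refine ((Integrable.add_measure ?_ ?_).add_measure ?_).add_measure (hs _ _)
  · exact integrable_finsetSum_measure.2 fun i _ => hs _ _
  · exact integrable_finsetSum_measure.2 fun i _ =>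
      integrable_finsetSum_measure.2 fun j _ => hs _ _
  · exact integrable_finsetSum_measure.2 fun i _ => hs _ _

theorem lintegral_kernel (ψ : (Fin ℓ → ℕ) → ENNReal) (y : Fin ℓ → ℕ) :
    ∫⁻ z, ψ z ∂(N.kernel ρ w y)
      = ∑ i, ENNReal.ofReal (ρ * N.arrival i) * ψ (y + Pi.single i 1)
        + ∑ i, ∑ j, ENNReal.ofReal (N.service i * w.alloc y i * N.routing i j) *
            ψ (y - Pi.single i 1 + Pi.single j 1)
        + ∑ i, ENNReal.ofReal (N.service i * w.alloc y i * (1 - ∑ j, N.routing i j)) *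
            ψ (y - Pi.single i 1)
        + ENNReal.ofReal (1 - ∑ i, ρ * N.arrival i - ∑ i, N.service i * w.alloc y i) * ψ y := by
  change ∫⁻ z, ψ z ∂(N.step ρ w y) = _
  simp only [step, lintegral_add_measure, lintegral_finsetSum_measure, lintegral_smul_measure,
    lintegral_dirac, smul_eq_mul]

theorem integral_kernel (ψ : (Fin ℓ → ℕ) → ℝ) (y : Fin ℓ → ℕ) :
    ∫ z, ψ z ∂(N.kernel ρ w y)
      = ∑ i, (ρ * N.arrival i) * ψ (y + Pi.single i 1)
        + ∑ i, ∑ j, (N.service i * w.alloc y i * N.routing i j) *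
            ψ (y - Pi.single i 1 + Pi.single j 1)
        + ∑ i, (N.service i * w.alloc y i * (1 - ∑ j, N.routing i j)) * ψ (y - Pi.single i 1)
        + (1 - ∑ i, ρ * N.arrival i - ∑ i, N.service i * w.alloc y i) * ψ y := by
  have hd : ∀ z : Fin ℓ → ℕ, Integrable ψ (Measure.dirac z) := fun z =>
    integrable_dirac (by simp)
  have hs : ∀ (r : ℝ) (z : Fin ℓ → ℕ),
      Integrable ψ (ENNReal.ofReal r • Measure.dirac z) :=
    fun r z => (hd z).smul_measure ENNReal.ofReal_ne_top
  have hv : ∀ {r : ℝ} (z : Fin ℓ → ℕ), 0 ≤ r →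
      ∫ x, ψ x ∂(ENNReal.ofReal r • Measure.dirac z) = r * ψ z := by
    intro r z hr
    rw [integral_smul_measure, integral_dirac, ENNReal.toReal_ofReal hr, smul_eq_mul]
  have i1 := fun i (_ : i ∈ Finset.univ) => hs (ρ * N.arrival i) (y + Pi.single i 1)
  have i2 := fun i j (_ : j ∈ Finset.univ) =>
    hs (N.service i * w.alloc y i * N.routing i j) (y - Pi.single i 1 + Pi.single j 1)
  have i2' := fun i (_ : i ∈ Finset.univ) => integrable_finsetSum_measure.2 (i2 i)
  have i3 := fun i (_ : i ∈ Finset.univ) =>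
    hs (N.service i * w.alloc y i * (1 - ∑ j, N.routing i j)) (y - Pi.single i 1)
  change ∫ z, ψ z ∂(N.step ρ w y) = _
  unfold step
  rw [integral_add_measure (((integrable_finsetSum_measure.2 i1).add_measure
      (integrable_finsetSum_measure.2 i2')).add_measure
      (integrable_finsetSum_measure.2 i3)) (hs _ _),
    integral_add_measure ((integrable_finsetSum_measure.2 i1).add_measure
      (integrable_finsetSum_measure.2 i2')) (integrable_finsetSum_measure.2 i3),
    integral_add_measure (integrable_finsetSum_measure.2 i1)
      (integrable_finsetSum_measure.2 i2'),
    integral_finsetSum_measure i1, integral_finsetSum_measure i2',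
    integral_finsetSum_measure i3, hv _ (N.idleRate_nonneg ρ w y)]
  congr 1
  congr 1
  · congr 1
    · exact Finset.sum_congr rfl fun i _ => hv _ (N.arrivalRate_nonneg ρ i)
    · refine Finset.sum_congr rfl fun i _ => ?_
      rw [integral_finsetSum_measure (i2 i)]
      exact Finset.sum_congr rfl fun j _ => hv _ (N.routeRate_nonneg w y i j)
  · exact Finset.sum_congr rfl fun i _ => hv _ (N.exitRate_nonneg w y i)

theorem drift_kernel (ψ : (Fin ℓ → ℕ) → ℝ) (y : Fin ℓ → ℕ) :
    drift (N.kernel ρ w) ψ y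
      = ∑ i, (ρ * N.arrival i) * (ψ (y + Pi.single i 1) - ψ y)
        + ∑ i, N.service i * w.alloc y i *
            (∑ j, N.routing i j * (ψ (y - Pi.single i 1 + Pi.single j 1) - ψ y)
              + (1 - ∑ j, N.routing i j) * (ψ (y - Pi.single i 1) - ψ y)) := by
  rw [drift, integral_kernel]
  simp only [mul_sub, mul_add, Finset.sum_sub_distrib, Finset.sum_add_distrib, sub_mul, one_mul,
    ← Finset.sum_mul, Finset.mul_sum, mul_one, ← mul_assoc]
  ring

theorem drift_of_increments {ψ : (Fin ℓ → ℕ) → ℝ} {y : Fin ℓ → ℕ} {a c : Fin ℓ → ℝ}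
    {b : Fin ℓ → Fin ℓ → ℝ} (ha : ∀ i, ψ (y + Pi.single i 1) = ψ y + a i)
    (hb : ∀ i, y i ≠ 0 → ∀ j, ψ (y - Pi.single i 1 + Pi.single j 1) = ψ y + b i j)
    (hc : ∀ i, y i ≠ 0 → ψ (y - Pi.single i 1) = ψ y + c i) :
    drift (N.kernel ρ w) ψ y
      = ρ * ∑ i, N.arrival i * a i
        + ∑ i, N.service i * w.alloc y i *
            (∑ j, N.routing i j * b i j + (1 - ∑ j, N.routing i j) * c i) := by
  rw [drift_kernel]
  congr 1
  · rw [Finset.mul_sum]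
    exact Finset.sum_congr rfl fun i _ => by rw [ha]; ring
  · refine Finset.sum_congr rfl fun i _ => ?_
    by_cases hi : y i = 0
    · rw [w.alloc_of_empty y i hi]; simp
    · rw [hc i hi]
      simp only [hb i hi, add_sub_cancel_left]

theorem sum_arrival_mul_le_integral {ψ : (Fin ℓ → ℕ) → ℝ} (hψ : ∀ z, 0 ≤ ψ z) (y : Fin ℓ → ℕ) :
    ∑ i, (ρ * N.arrival i) * ψ (y + Pi.single i 1) ≤ ∫ z, ψ z ∂(N.kernel ρ w y) := by
  rw [integral_kernel]
  have h2 : 0 ≤ ∑ i, ∑ j, (N.service i * w.alloc y i * N.routing i j) *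
      ψ (y - Pi.single i 1 + Pi.single j 1) := Finset.sum_nonneg fun i _ =>
    Finset.sum_nonneg fun j _ => mul_nonneg (N.routeRate_nonneg w y i j) (hψ _)
  have h3 : 0 ≤ ∑ i, (N.service i * w.alloc y i * (1 - ∑ j, N.routing i j)) *
      ψ (y - Pi.single i 1) := Finset.sum_nonneg fun i _ =>
    mul_nonneg (N.exitRate_nonneg w y i) (hψ _)
  have h4 := mul_nonneg (N.idleRate_nonneg ρ w y) (hψ y)
  linarith

theorem ae_kernel {y : Fin ℓ → ℕ} {p : (Fin ℓ → ℕ) → Prop}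
    (hp : ∀ z, (∀ i, |levels z i - levels y i| ≤ 1) → p z) : ∀ᵐ z ∂(N.kernel ρ w y), p z := by
  rw [ae_iff, ← lintegral_indicator_one (DiscreteMeasurableSpace.forall_measurableSet _),
    lintegral_kernel]
  have hz : ∀ z, (∀ i, |levels z i - levels y i| ≤ 1) →
      Set.indicator {a | ¬ p a} (1 : (Fin ℓ → ℕ) → ENNReal) z = 0 := fun z h =>
    Set.indicator_of_notMem (by simpa using hp z h) _
  have habs : ∀ a b : ℕ, a ≤ b + 1 → b ≤ a + 1 → |(a : ℝ) - b| ≤ 1 := by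
    intro a b h1 h2
    have h1' : (a : ℝ) ≤ b + 1 := by exact_mod_cast h1
    have h2' : (b : ℝ) ≤ a + 1 := by exact_mod_cast h2
    rw [abs_le]
    constructor <;> linarith
  have e1 : ∀ i, ∀ k, |levels (y + Pi.single i 1) k - levels y k| ≤ 1 := by
    intro i k
    refine habs _ _ ?_ ?_ <;> simp only [Pi.add_apply, Pi.single_apply] <;> split_ifs <;> omega
  have e2 : ∀ i j, ∀ k, |levels (y - Pi.single i 1 + Pi.single j 1) k - levels y k| ≤ 1 := by
    intro i j k
    refine habs _ _ ?_ ?_ <;> simp only [Pi.add_apply, Pi.sub_apply, Pi.single_apply] <;>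
      split_ifs <;> omega
  have e3 : ∀ i, ∀ k, |levels (y - Pi.single i 1) k - levels y k| ≤ 1 := by
    intro i k
    refine habs _ _ ?_ ?_ <;> simp only [Pi.sub_apply, Pi.single_apply] <;> split_ifs <;> omega
  simp [hz _ (e1 _), hz _ (e2 _ _), hz _ (e3 _), hz y (by simp)]

end Step

/-! ### Linear and quadratic functions of the buffer levels -/

theorem dotProduct_levels_add (c : Fin ℓ → ℝ) (y : Fin ℓ → ℕ) (i : Fin ℓ) :
    c ⬝ᵥ levels (y + Pi.single i 1) = c ⬝ᵥ levels y + c i := by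
  have h : levels (y + Pi.single i 1) = levels y + Pi.single i 1 := by
    funext k
    by_cases hk : k = i
    · subst hk; simp [levels]
    · simp [levels, hk]
  rw [h, dotProduct_add, dotProduct_single_one]

theorem dotProduct_levels_sub (c : Fin ℓ → ℝ) {y : Fin ℓ → ℕ} {i : Fin ℓ} (hi : y i ≠ 0) :
    c ⬝ᵥ levels (y - Pi.single i 1) = c ⬝ᵥ levels y - c i := by
  have h : y - Pi.single i 1 + Pi.single i 1 = y := by
    funext k
    by_cases hk : k = i
    · subst hk
      simp only [Pi.add_apply, Pi.sub_apply, Pi.single_eq_same]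
      omega
    · simp [hk]
  have h1 := dotProduct_levels_add c (y - Pi.single i 1) i
  rw [h] at h1
  linarith

/-- The mean squared change of the workload at a service completion of class `i`. -/
noncomputable def sqDecrement (i : Fin ℓ) : ℝ :=
  ∑ j, N.routing i j * (N.d j - N.d i) ^ 2 + (1 - ∑ j, N.routing i j) * N.d i ^ 2

theorem service_mul_d_sub (i : Fin ℓ) :
    N.service i * (N.d i - ∑ j, N.routing i j * N.d j) = 1 := by
  rw [d_sub]
  exact mul_inv_cancel₀ (N.service_pos i).ne'

/-- A service completion can decrease the workload by at least `1 / 2`, because the mean decrease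
is `1 / service i`, which is at least `1`. -/
theorem exists_route (i : Fin ℓ) :
    (∃ j, 0 < N.routing i j ∧ N.d j ≤ N.d i - 1 / 2) ∨
      (0 < 1 - ∑ j, N.routing i j ∧ 1 / 2 ≤ N.d i) := by
  by_contra! h
  obtain ⟨h1, h2⟩ := h
  have hr : ∀ j, N.routing i j * (N.d i - N.d j - 1 / 2) ≤ 0 := by
    intro j
    rcases (N.routing_nonneg i j).eq_or_lt with h | h
    · rw [← h, zero_mul]
    · exact mul_nonpos_of_nonneg_of_nonpos h.le (by linarith [h1 j h])
  have he : (1 - ∑ j, N.routing i j) * (N.d i - 1 / 2) ≤ 0 := by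
    rcases (sub_nonneg.2 (N.routing_row_le_one i)).eq_or_lt with h | h
    · rw [← h, zero_mul]
    · exact mul_nonpos_of_nonneg_of_nonpos h.le (by linarith [h2 h])
  have hs := Finset.sum_nonpos fun j (_ : j ∈ Finset.univ) => hr j
  simp only [mul_sub, Finset.sum_sub_distrib, ← Finset.sum_mul] at hs
  have h3 := N.d_sub i
  have h4 := (one_le_inv₀ (N.service_pos i)).2 (N.service_le_one i)
  linarith

theorem sqDecrement_pos (i : Fin ℓ) : 0 < N.sqDecrement i := by
  have h1 : ∀ j, 0 ≤ N.routing i j * (N.d j - N.d i) ^ 2 := fun j =>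
    mul_nonneg (N.routing_nonneg i j) (sq_nonneg _)
  have h2 : 0 ≤ (1 - ∑ j, N.routing i j) * N.d i ^ 2 :=
    mul_nonneg (sub_nonneg.2 (N.routing_row_le_one i)) (sq_nonneg _)
  rcases N.exists_route i with ⟨j, hj, hd⟩ | ⟨he, hd⟩
  · refine add_pos_of_pos_of_nonneg (Finset.sum_pos' (fun j _ => h1 j) ⟨j, Finset.mem_univ j, ?_⟩)
      h2
    exact mul_pos hj (by nlinarith)
  · refine add_pos_of_nonneg_of_pos (Finset.sum_nonneg fun j _ => h1 j) ?_
    exact mul_pos he (by nlinarith)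

/-- The direction of the linear part of the solution of Poisson's equation for the workload. -/
noncomputable def linearPart : Fin ℓ → ℝ := N.visitSum N.sqDecrement

theorem linearPart_pos (i : Fin ℓ) : 0 < N.linearPart i :=
  (N.sqDecrement_pos i).trans_le (N.le_visitSum (fun j => (N.sqDecrement_pos j).le) i)

section Drift

variable (ρ : Set.Ioo (0 : ℝ) 1) (w : NonIdlingPolicy ℓ)

/-- The drift of `α f² + c'y` is affine in the workload, up to a term that depends on the
allocation. -/
theorem drift_quadratic (hload : ∑ i, (N.Q *ᵥ N.arrival) i = 1) (α : ℝ) (c : Fin ℓ → ℝ)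
    (y : Fin ℓ → ℕ) :
    drift (N.kernel ρ w) (fun z => α * N.f (levels z) ^ 2 + c ⬝ᵥ levels z) y
      = -(2 * α * (1 - ρ)) * N.f (levels y)
        + ρ * ∑ i, N.arrival i * (α * N.d i ^ 2 + c i)
        + ∑ i, N.service i * w.alloc y i *
          (α * N.sqDecrement i - (c i - ∑ j, N.routing i j * c j)) := by
  have hadd := fun i => dotProduct_levels_add N.d y i
  have hsub := fun i (hi : y i ≠ 0) => dotProduct_levels_sub N.d hi
  set F := N.f (levels y) with hF
  have hF' : N.d ⬝ᵥ levels y = F := rfl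
  rw [drift_of_increments N ρ w
    (a := fun i => α * (2 * F * N.d i + N.d i ^ 2) + c i)
    (b := fun i j => α * (2 * F * (N.d j - N.d i) + (N.d j - N.d i) ^ 2) + (c j - c i))
    (c := fun i => α * (-(2 * F * N.d i) + N.d i ^ 2) - c i)]
  rotate_left
  · intro i
    simp only [f, dotProduct_levels_add, hF']
    ring
  · intro i hi j
    simp only [f, dotProduct_levels_add, dotProduct_levels_sub _ hi, hF']
    ring
  · intro i hi
    simp only [f, dotProduct_levels_sub _ hi, hF']
    ring
  have hwork : F * ∑ i, w.alloc y i = F := by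
    by_cases hy : y = 0
    · have : F = 0 := by
        rw [hF, hy, f]
        have : levels (0 : Fin ℓ → ℕ) = 0 := by funext k; simp [levels]
        rw [this, dotProduct_zero]
      rw [this, zero_mul]
    · rw [w.nonidling y hy, mul_one]
  have h1 : ∑ i, N.arrival i * (α * (2 * F * N.d i + N.d i ^ 2) + c i)
      = 2 * α * F + ∑ i, N.arrival i * (α * N.d i ^ 2 + c i) := by
    have h := N.d_dotProduct_arrival hload
    calc _ = ∑ i, (2 * α * F * (N.arrival i * N.d i)
          + N.arrival i * (α * N.d i ^ 2 + c i)) :=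
            Finset.sum_congr rfl fun i _ => by ring
      _ = _ := by rw [Finset.sum_add_distrib, ← Finset.mul_sum, h, mul_one]
  have h2 : ∀ i, N.service i * w.alloc y i *
      (∑ j, N.routing i j * (α * (2 * F * (N.d j - N.d i) + (N.d j - N.d i) ^ 2) + (c j - c i))
        + (1 - ∑ j, N.routing i j) * (α * (-(2 * F * N.d i) + N.d i ^ 2) - c i))
      = -(2 * α) * (F * w.alloc y i) + N.service i * w.alloc y i *
          (α * N.sqDecrement i - (c i - ∑ j, N.routing i j * c j)) := by
    intro i
    have h := N.service_mul_d_sub i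
    have h3 : ∑ j, N.routing i j * (α * (2 * F * (N.d j - N.d i) + (N.d j - N.d i) ^ 2)
          + (c j - c i))
        = 2 * α * F * ∑ j, N.routing i j * N.d j - 2 * α * F * N.d i * ∑ j, N.routing i j
          + α * ∑ j, N.routing i j * (N.d j - N.d i) ^ 2
          + ∑ j, N.routing i j * c j - c i * ∑ j, N.routing i j := by
      simp only [Finset.mul_sum, ← Finset.sum_add_distrib, ← Finset.sum_sub_distrib]
      exact Finset.sum_congr rfl fun j _ => by ring
    rw [h3, sqDecrement]
    linear_combination (-(2 * α * F) * w.alloc y i) * h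
  rw [h1, Finset.sum_congr rfl fun i _ => h2 i, Finset.sum_add_distrib, ← Finset.mul_sum,
    ← Finset.mul_sum, hwork]
  ring

end Drift

end Station

/-! ### Drift of powers of the workload -/

namespace Station

variable {ℓ : ℕ} (N : Station ℓ)

theorem f_levels_nonneg (y : Fin ℓ → ℕ) : 0 ≤ N.f (levels y) := by
  rw [f, dotProduct]
  exact Finset.sum_nonneg fun i _ => mul_nonneg (N.d_pos i).le (Nat.cast_nonneg _)

theorem f_levels_zero : N.f (levels (0 : Fin ℓ → ℕ)) = 0 := by
  simp [f, levels, dotProduct]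

/-- The total of the workload vector bounds the change of the workload in one transition. -/
noncomputable def dTotal : ℝ := ∑ i, N.d i

theorem dTotal_nonneg : 0 ≤ N.dTotal := Finset.sum_nonneg fun i _ => (N.d_pos i).le

theorem abs_dotProduct_sub_le {c : Fin ℓ → ℝ} (hc : ∀ i, 0 ≤ c i) {y z : Fin ℓ → ℕ}
    (h : ∀ i, |levels z i - levels y i| ≤ 1) : |c ⬝ᵥ levels z - c ⬝ᵥ levels y| ≤ ∑ i, c i := by
  rw [← dotProduct_sub]
  refine (Finset.abs_sum_le_sum_abs _ _).trans (Finset.sum_le_sum fun i _ => ?_)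
  rw [abs_mul, abs_of_nonneg (hc i)]
  exact mul_le_of_le_one_right (hc i) (h i)

theorem abs_f_sub_le {y z : Fin ℓ → ℕ} (h : ∀ i, |levels z i - levels y i| ≤ 1) :
    |N.f (levels z) - N.f (levels y)| ≤ N.dTotal :=
  abs_dotProduct_sub_le (fun i => (N.d_pos i).le) h

theorem f_le {x : Fin ℓ → ℝ} (hx : 0 ≤ x) : N.f x ≤ N.dTotal * ∑ i, |x i| := by
  rw [f, dotProduct, Finset.mul_sum]
  refine Finset.sum_le_sum fun i _ => ?_
  rw [abs_of_nonneg (hx i)]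
  exact mul_le_mul_of_nonneg_right
    (Finset.single_le_sum (fun j _ => (N.d_pos j).le) (Finset.mem_univ i)) (hx i)

theorem exists_le_f : ∃ m : ℝ, 0 < m ∧ ∀ x : Fin ℓ → ℝ, 0 ≤ x → m * ∑ i, |x i| ≤ N.f x := by
  obtain ⟨i₀, h⟩ := haveI := N.nonempty_class; Finite.exists_min N.d
  refine ⟨N.d i₀, N.d_pos i₀, fun x hx => ?_⟩
  rw [f, dotProduct, Finset.mul_sum]
  refine Finset.sum_le_sum fun i _ => ?_
  rw [abs_of_nonneg (hx i)]
  exact mul_le_mul_of_nonneg_right (h i) (hx i)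

theorem levels_nonneg (y : Fin ℓ → ℕ) : 0 ≤ levels y := fun _ => Nat.cast_nonneg _

section Kernel

variable (ρ : Set.Ioo (0 : ℝ) 1) (w : NonIdlingPolicy ℓ)

/-- Service of a nonempty class leads to a state of smaller workload with positive probability. -/
theorem exists_transition_decreasing {y : Fin ℓ → ℕ} (hy : y ≠ 0) :
    ∃ z, N.kernel ρ w y {z} ≠ 0 ∧ N.f (levels z) ≤ N.f (levels y) - 1 / 2 := by
  obtain ⟨i, hi⟩ : ∃ i, w.alloc y i ≠ 0 := by
    by_contra! h
    have := w.nonidling y hy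
    simp [h] at this
  have hyi : y i ≠ 0 := fun h => hi (w.alloc_of_empty y i h)
  have hs : 0 < N.service i * w.alloc y i :=
    mul_pos (N.service_pos i) (lt_of_le_of_ne (w.alloc_nonneg y i) (Ne.symm hi))
  have hK : ∀ z, N.kernel ρ w y {z} = 0 →
      (∀ j, y - Pi.single i 1 + Pi.single j 1 = z →
        N.service i * w.alloc y i * N.routing i j ≤ 0) ∧
      (y - Pi.single i 1 = z → N.service i * w.alloc y i * (1 - ∑ j, N.routing i j) ≤ 0) := by
    intro z h
    rw [← lintegral_indicator_one (measurableSet_singleton z), lintegral_kernel] at h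
    simp only [add_eq_zero, Finset.sum_eq_zero_iff, Finset.mem_univ, true_imp_iff] at h
    obtain ⟨⟨⟨-, h1⟩, h2⟩, -⟩ := h
    constructor
    · intro j hj
      have := h1 i j
      rw [hj, Set.indicator_of_mem (Set.mem_singleton z)] at this
      simpa using this
    · intro hz
      have := h2 i
      rw [hz, Set.indicator_of_mem (Set.mem_singleton z)] at this
      simpa using this
  rcases N.exists_route i with ⟨j, hj, hd⟩ | ⟨he, hd⟩
  · refine ⟨y - Pi.single i 1 + Pi.single j 1, fun h => ?_, ?_⟩
    · exact absurd ((hK _ h).1 j rfl) (not_le.2 (mul_pos hs hj))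
    · rw [f, dotProduct_levels_add, dotProduct_levels_sub _ hyi, f]
      linarith
  · refine ⟨y - Pi.single i 1, fun h => ?_, ?_⟩
    · exact absurd ((hK _ h).2 rfl) (not_le.2 (mul_pos hs he))
    · rw [f, dotProduct_levels_sub _ hyi, f]
      linarith

/-- The system can empty from every state, by service completions that decrease the workload. -/
theorem reach_zero (y : Fin ℓ → ℕ) :
    Relation.ReflTransGen (fun y z => N.kernel ρ w y {z} ≠ 0) y 0 := by
  have key : ∀ n : ℕ, ∀ y : Fin ℓ → ℕ, N.f (levels y) < n / 2 →
      Relation.ReflTransGen (fun y z => N.kernel ρ w y {z} ≠ 0) y 0 := by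
    intro n
    induction n with
    | zero =>
      intro y hy
      have := N.f_levels_nonneg y
      simp at hy
      linarith
    | succ n ih =>
      intro y hy
      by_cases h0 : y = 0
      · rw [h0]
      · obtain ⟨z, hz, hf⟩ := N.exists_transition_decreasing ρ w h0
        refine Relation.ReflTransGen.head hz (ih z ?_)
        push_cast at hy
        linarith
  obtain ⟨n, hn⟩ := exists_nat_gt (2 * N.f (levels y))
  exact key n y (by linarith)

variable (hload : ∑ i, (N.Q *ᵥ N.arrival) i = 1)
include hload

theorem integral_f_kernel (y : Fin ℓ → ℕ) :
    ∫ z, (N.f (levels z) - N.f (levels y)) ∂(N.kernel ρ w y) = ρ - ∑ i, w.alloc y i := by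
  have h := N.drift_quadratic ρ w hload 0 N.d y
  have h1 := N.d_dotProduct_arrival hload
  have h2 : ∀ i, N.service i * w.alloc y i *
      (0 * N.sqDecrement i - (N.d i - ∑ j, N.routing i j * N.d j)) = - w.alloc y i := by
    intro i
    linear_combination (-w.alloc y i) * N.service_mul_d_sub i
  simp only [h2, Finset.sum_neg_distrib] at h
  simp only [zero_mul, zero_add, mul_zero, h1, mul_one, neg_zero] at h
  rw [integral_sub (N.integrable_kernel ρ w _ y) (integrable_const _)]
  simp only [integral_const, probReal_univ, one_smul]
  rw [← sub_eq_add_neg] at h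
  exact h

theorem integral_f_kernel_of_ne {y : Fin ℓ → ℕ} (hy : y ≠ 0) :
    ∫ z, (N.f (levels z) - N.f (levels y)) ∂(N.kernel ρ w y) = -(1 - ρ) := by
  rw [integral_f_kernel N ρ w hload, w.nonidling y hy]
  ring

/-- The factor `f y` makes the formula for nonempty states valid at `0` as well. -/
theorem f_mul_integral_f_kernel (y : Fin ℓ → ℕ) :
    N.f (levels y) * ∫ z, (N.f (levels z) - N.f (levels y)) ∂(N.kernel ρ w y)
      = -(1 - ρ) * N.f (levels y) := by
  by_cases hy : y = 0
  · subst hy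
    simp [f_levels_zero]
  · rw [integral_f_kernel_of_ne N ρ w hload hy]
    ring

omit hload in
/-- A pointwise bound on a function of the workload by its linearization at `y` gives a bound on its
mean after one transition. -/
theorem integral_kernel_le {ψ : (Fin ℓ → ℕ) → ℝ} {y : Fin ℓ → ℕ} {p q : ℝ}
    (h : ∀ z, |N.f (levels z) - N.f (levels y)| ≤ N.dTotal →
      ψ z ≤ p + q * (N.f (levels z) - N.f (levels y))) :
    ∫ z, ψ z ∂(N.kernel ρ w y)
      ≤ p + q * ∫ z, (N.f (levels z) - N.f (levels y)) ∂(N.kernel ρ w y) := by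
  have hi := fun φ => N.integrable_kernel ρ w φ y
  calc ∫ z, ψ z ∂(N.kernel ρ w y)
      ≤ ∫ z, (p + q * (N.f (levels z) - N.f (levels y))) ∂(N.kernel ρ w y) :=
        integral_mono_ae (hi _) (hi _) (N.ae_kernel ρ w fun z hz => h z (N.abs_f_sub_le hz))
    _ = _ := by
        rw [integral_add (hi _) (hi _), integral_const_mul]
        simp

theorem integral_f_sq_le (y : Fin ℓ → ℕ) :
    ∫ z, N.f (levels z) ^ 2 ∂(N.kernel ρ w y)
      ≤ N.f (levels y) ^ 2 - 2 * (1 - ρ) * N.f (levels y) + N.dTotal ^ 2 := by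
  refine (N.integral_kernel_le ρ w (p := N.f (levels y) ^ 2 + N.dTotal ^ 2)
    (q := 2 * N.f (levels y)) fun z hz => ?_).trans (le_of_eq ?_)
  · have := sq_le_sq' (neg_le_of_abs_le hz) (le_of_abs_le hz)
    nlinarith
  · linear_combination 2 * f_mul_integral_f_kernel N ρ w hload y

theorem integral_f_cube_le (y : Fin ℓ → ℕ) :
    ∫ z, N.f (levels z) ^ 3 ∂(N.kernel ρ w y)
      ≤ N.f (levels y) ^ 3 - 3 * (1 - ρ) * N.f (levels y) ^ 2
        + 3 * N.dTotal ^ 2 * N.f (levels y) + N.dTotal ^ 3 := by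
  have h0 := N.f_levels_nonneg y
  refine (N.integral_kernel_le ρ w
    (p := N.f (levels y) ^ 3 + 3 * N.dTotal ^ 2 * N.f (levels y) + N.dTotal ^ 3)
    (q := 3 * N.f (levels y) ^ 2) fun z hz => ?_).trans (le_of_eq ?_)
  · set t := N.f (levels z) - N.f (levels y) with ht
    have e : N.f (levels z) = N.f (levels y) + t := by rw [ht]; ring
    have h2 : t ^ 2 ≤ N.dTotal ^ 2 := sq_le_sq' (neg_le_of_abs_le hz) (le_of_abs_le hz)
    have h3 : t ^ 3 ≤ N.dTotal ^ 3 :=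
      (le_abs_self _).trans (by rw [abs_pow]; exact pow_le_pow_left₀ (abs_nonneg t) hz 3)
    have h4 := mul_le_mul_of_nonneg_left h2 h0
    rw [e]
    linarith [show (N.f (levels y) + t) ^ 3 = N.f (levels y) ^ 3 + 3 * N.f (levels y) ^ 2 * t
      + 3 * (N.f (levels y) * t ^ 2) + t ^ 3 by ring]
  · linear_combination 3 * N.f (levels y) * f_mul_integral_f_kernel N ρ w hload y

omit hload in
theorem exists_cubic_le_quartic {S ε : ℝ} (hS : 0 ≤ S) (hε : 0 < ε) :
    ∃ C : ℝ, 0 ≤ C ∧ ∀ a : ℝ, 0 ≤ a →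
      10 * S ^ 2 * a ^ 3 + 10 * S ^ 3 * a ^ 2 + 5 * S ^ 4 * a + S ^ 5 ≤ ε * a ^ 4 + C := by
  set T := 10 * S ^ 2 + 10 * S ^ 3 + 5 * S ^ 4 + S ^ 5 with hT
  set m := max 1 (T / ε) with hm
  have hm0 : 0 ≤ m := le_trans zero_le_one (le_max_left _ _)
  refine ⟨10 * S ^ 2 * m ^ 3 + 10 * S ^ 3 * m ^ 2 + 5 * S ^ 4 * m + S ^ 5, by positivity,
    fun a ha => ?_⟩
  rcases le_total a m with h | h
  · have : 0 ≤ ε * a ^ 4 := by positivity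
    have : 10 * S ^ 2 * a ^ 3 + 10 * S ^ 3 * a ^ 2 + 5 * S ^ 4 * a + S ^ 5
        ≤ 10 * S ^ 2 * m ^ 3 + 10 * S ^ 3 * m ^ 2 + 5 * S ^ 4 * m + S ^ 5 := by gcongr
    linarith
  · have h1 : 1 ≤ a := (le_max_left _ _).trans h
    have h2 : T ≤ ε * a := by
      have := (le_max_right 1 (T / ε)).trans h
      rw [div_le_iff₀ hε] at this
      linarith
    have e2 : a ^ 2 ≤ a ^ 3 := pow_le_pow_right₀ h1 (by norm_num)
    have e1 : a ≤ a ^ 3 := le_self_pow₀ h1 (by norm_num)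
    have e0 : 1 ≤ a ^ 3 := one_le_pow₀ h1
    have hpos : 0 ≤ 10 * S ^ 2 * m ^ 3 + 10 * S ^ 3 * m ^ 2 + 5 * S ^ 4 * m + S ^ 5 := by
      positivity
    have k2 := mul_le_mul_of_nonneg_left e2 (show 0 ≤ 10 * S ^ 3 by positivity)
    have k1 := mul_le_mul_of_nonneg_left e1 (show 0 ≤ 5 * S ^ 4 by positivity)
    have k0 := mul_le_mul_of_nonneg_left e0 (show 0 ≤ S ^ 5 by positivity)
    have k := mul_le_mul_of_nonneg_right h2 (show 0 ≤ a ^ 3 by positivity)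
    rw [hT] at k
    linarith [show ε * a * a ^ 3 = ε * a ^ 4 by ring]

theorem exists_integral_f_quintic_le : ∃ C : ℝ, 0 ≤ C ∧ ∀ y : Fin ℓ → ℕ,
    ∫ z, N.f (levels z) ^ 5 ∂(N.kernel ρ w y)
      ≤ N.f (levels y) ^ 5 - (1 - ρ) * N.f (levels y) ^ 4 + C := by
  have hρ : 0 < 1 - (ρ : ℝ) := sub_pos.2 ρ.2.2
  obtain ⟨C, hC0, hC⟩ := exists_cubic_le_quartic (ε := 4 * (1 - ρ)) N.dTotal_nonneg (by linarith)
  refine ⟨C, hC0, fun y => ?_⟩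
  have h0 := N.f_levels_nonneg y
  have hCy := hC _ h0
  have hF := f_mul_integral_f_kernel N ρ w hload y
  refine (N.integral_kernel_le ρ w
    (p := N.f (levels y) ^ 5 + (10 * N.dTotal ^ 2 * N.f (levels y) ^ 3
      + 10 * N.dTotal ^ 3 * N.f (levels y) ^ 2 + 5 * N.dTotal ^ 4 * N.f (levels y)
      + N.dTotal ^ 5)) (q := 5 * N.f (levels y) ^ 4) fun z hz => ?_).trans ?_
  · set t := N.f (levels z) - N.f (levels y) with ht
    have e : N.f (levels z) = N.f (levels y) + t := by rw [ht]; ring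
    have hp : ∀ n, t ^ n ≤ N.dTotal ^ n := fun n =>
      (le_abs_self _).trans (by rw [abs_pow]; exact pow_le_pow_left₀ (abs_nonneg t) hz n)
    have k2 := mul_le_mul_of_nonneg_left (hp 2) (pow_nonneg h0 3)
    have k3 := mul_le_mul_of_nonneg_left (hp 3) (pow_nonneg h0 2)
    have k4 := mul_le_mul_of_nonneg_left (hp 4) h0
    have k5 := hp 5
    rw [e]
    linarith [show (N.f (levels y) + t) ^ 5 = N.f (levels y) ^ 5 + 5 * N.f (levels y) ^ 4 * t
      + 10 * (N.f (levels y) ^ 3 * t ^ 2) + 10 * (N.f (levels y) ^ 2 * t ^ 3)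
      + 5 * (N.f (levels y) * t ^ 4) + t ^ 5 by ring]
  · have : 5 * N.f (levels y) ^ 4 * ∫ z, (N.f (levels z) - N.f (levels y)) ∂(N.kernel ρ w y)
        = -(5 * (1 - ρ)) * N.f (levels y) ^ 4 := by
      linear_combination 5 * N.f (levels y) ^ 3 * hF
    rw [this]
    linarith

/-- Off a bounded set the term `-(1 - ρ) f ^ 4` dominates the cubic remainder of the drift of
`f ^ 5`; the constant `b` only has to turn `(1 - ρ) f ^ 4` into `|y| ^ 4`. -/
theorem exists_satisfiesA : ∃ b₀ : ℝ, 0 < b₀ ∧ ∀ b : ℝ, b₀ ≤ b →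
    SatisfiesA (N.kernel ρ w) (fun x => b * N.f x ^ 5 + 1) := by
  have hρ : 0 < 1 - (ρ : ℝ) := sub_pos.2 ρ.2.2
  obtain ⟨m, hm, hmf⟩ := N.exists_le_f
  obtain ⟨C, hC0, hC⟩ := exists_integral_f_quintic_le N ρ w hload
  refine ⟨((1 - ρ) * m ^ 4)⁻¹, by positivity, fun b hb => ?_⟩
  have hb0 : 0 < b := lt_of_lt_of_le (by positivity) hb
  have hS := N.dTotal_nonneg
  have hfx : ∀ x : Fin ℓ → ℝ, 0 ≤ x → 0 ≤ N.f x := fun x hx =>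
    le_trans (mul_nonneg hm.le (Finset.sum_nonneg fun i _ => abs_nonneg _)) (hmf x hx)
  refine ⟨fun x hx => ?_, ?_, ?_⟩
  · have := hfx x hx
    positivity
  · set δ := min (min (b * m ^ 5) (b * N.dTotal ^ 5 + 1)⁻¹) (1 / 2) with hδ
    have hδ0 : 0 < δ := lt_min (lt_min (by positivity) (by positivity)) (by norm_num)
    have hδ1 : δ ≤ 1 / 2 := min_le_right _ _
    have hδ2 : δ ≤ b * m ^ 5 := (min_le_left _ _).trans (min_le_left _ _)
    have hδ3 : b * N.dTotal ^ 5 + 1 ≤ δ⁻¹ := by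
      rw [le_inv_comm₀ (by positivity) hδ0]
      exact (min_le_left _ _).trans (min_le_right _ _)
    refine ⟨δ, hδ0, by linarith, fun x hx => ?_⟩
    set s := ∑ i, |x i| with hs
    have hs0 : 0 ≤ s := Finset.sum_nonneg fun i _ => abs_nonneg _
    have hl : (m * s) ^ 5 ≤ N.f x ^ 5 := pow_le_pow_left₀ (by positivity) (hmf x hx) 5
    have hu : N.f x ^ 5 ≤ (N.dTotal * s) ^ 5 := pow_le_pow_left₀ (hfx x hx) (N.f_le hx) 5
    have hs5 : 0 ≤ s ^ 5 := by positivity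
    constructor
    · calc δ * (s ^ 5 + 1) = δ * s ^ 5 + δ := by ring
        _ ≤ b * m ^ 5 * s ^ 5 + 1 := by gcongr; linarith
        _ = b * (m * s) ^ 5 + 1 := by ring
        _ ≤ b * N.f x ^ 5 + 1 := by gcongr
    · calc b * N.f x ^ 5 + 1 ≤ b * (N.dTotal * s) ^ 5 + 1 := by gcongr
        _ ≤ (b * N.dTotal ^ 5 + 1) * (s ^ 5 + 1) := by
          have : 0 ≤ b * N.dTotal ^ 5 := by positivity
          nlinarith
        _ ≤ δ⁻¹ * (s ^ 5 + 1) := by gcongr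
  · refine ⟨b * C + 1, by positivity, fun y => ?_⟩
    set s := ∑ i, |levels y i| with hs
    have hs0 : 0 ≤ s := Finset.sum_nonneg fun i _ => abs_nonneg _
    have hl : (m * s) ^ 4 ≤ N.f (levels y) ^ 4 :=
      pow_le_pow_left₀ (by positivity) (hmf _ (levels_nonneg y)) 4
    have hi := fun φ => N.integrable_kernel ρ w φ y
    rw [drift, integral_add (hi _) (hi _), integral_const_mul]
    simp only [integral_const, probReal_univ, one_smul]
    have h1 := mul_le_mul_of_nonneg_left (hC y) hb0.le
    have h2 : s ^ 4 ≤ b * ((1 - ρ) * N.f (levels y) ^ 4) := by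
      have h3 : 1 ≤ b * ((1 - ρ) * m ^ 4) := by
        rwa [inv_le_iff_one_le_mul₀ (by positivity)] at hb
      calc s ^ 4 = 1 * s ^ 4 := (one_mul _).symm
        _ ≤ b * ((1 - ρ) * m ^ 4) * s ^ 4 := by gcongr
        _ = b * ((1 - ρ) * (m * s) ^ 4) := by ring
        _ ≤ _ := by gcongr
    linarith

end Kernel

end Station

/-! ### Stationary moments and solutions of Poisson's equation -/

theorem integral_drift_eq_zero {ℓ : ℕ} {K : Kernel (Fin ℓ → ℕ) (Fin ℓ → ℕ)} [IsMarkovKernel K]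
    {π : Measure (Fin ℓ → ℕ)} [IsProbabilityMeasure π] (hπ : Kernel.Invariant K π)
    {h : (Fin ℓ → ℕ) → ℝ} (hh : Integrable h π) : ∫ y, drift K h y ∂π = 0 := by
  simp only [drift]
  rw [integral_sub (integrable_integral_of_invariant hπ hh) hh,
    integral_integral_of_invariant hπ hh, sub_self]

namespace IsL2PoissonSolution

variable {ℓ : ℕ} {K : Kernel (Fin ℓ → ℕ) (Fin ℓ → ℕ)} {π : Measure (Fin ℓ → ℕ)}
  [IsProbabilityMeasure π]

/-- Poisson's equation is linear. -/
theorem linearCombination {g h : Fin ℓ → (Fin ℓ → ℕ) → ℝ}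
    (H : ∀ i, IsL2PoissonSolution K π (g i) (h i)) (c : Fin ℓ → ℝ) :
    IsL2PoissonSolution K π (fun y => ∑ i, c i * g i y) (fun y => ∑ i, c i * h i y) where
  memLp_function := memLp_finsetSum _ fun i _ => (H i).memLp_function.const_mul (c i)
  memLp_solution := memLp_finsetSum _ fun i _ => (H i).memLp_solution.const_mul (c i)
  integrable_step y := integrable_finsetSum _ fun i _ => ((H i).integrable_step y).const_mul (c i)
  poisson y := by
    have h1 := fun i => (H i).poisson y
    simp only [drift] at h1 ⊢
    rw [integral_finsetSum _ fun i _ => ((H i).integrable_step y).const_mul (c i),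
      integral_finsetSum _ fun i _ =>
        (((H i).memLp_function).integrable one_le_two).const_mul (c i)]
    simp only [integral_const_mul]
    rw [← Finset.sum_sub_distrib, ← Finset.sum_neg_distrib, ← Finset.sum_add_distrib]
    refine Finset.sum_congr rfl fun i _ => ?_
    linear_combination c i * h1 i

theorem poissonIncrement_linearCombination {g h : Fin ℓ → (Fin ℓ → ℕ) → ℝ}
    (H : ∀ i, IsL2PoissonSolution K π (g i) (h i)) (c : Fin ℓ → ℝ)
    (p : (Fin ℓ → ℕ) × (Fin ℓ → ℕ)) :
    poissonIncrement π (fun y => ∑ i, c i * g i y) (fun y => ∑ i, c i * h i y) p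
      = ∑ i, c i * poissonIncrement π (g i) (h i) p := by
  simp only [poissonIncrement]
  rw [integral_finsetSum _ fun i _ =>
    (((H i).memLp_function).integrable one_le_two).const_mul (c i)]
  simp only [integral_const_mul, ← Finset.sum_sub_distrib, ← Finset.sum_add_distrib]
  exact Finset.sum_congr rfl fun i _ => by ring

end IsL2PoissonSolution

namespace Station

variable {ℓ : ℕ} (N : Station ℓ) (ρ : Set.Ioo (0 : ℝ) 1) (w : NonIdlingPolicy ℓ)

/-- The stationary distribution, as the normalized occupation measure of a busy cycle. -/
noncomputable def stationary : Measure (Fin ℓ → ℕ) := cycleProb (N.kernel ρ w) 0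

/-- The linear part of the solution of Poisson's equation for the workload. -/
noncomputable def poissonVector : Fin ℓ → ℝ := (2 * (1 - (ρ : ℝ)))⁻¹ • N.linearPart

/-- The solution of Poisson's equation for the workload. -/
noncomputable def workloadSolution (y : Fin ℓ → ℕ) : ℝ :=
  N.f (levels y) ^ 2 / (2 * (1 - (ρ : ℝ))) + N.poissonVector ρ ⬝ᵥ levels y

/-- The mean workload is `ρ / (2 * (1 - ρ))` times this number. -/
noncomputable def meanFactor : ℝ := ∑ i, N.arrival i * (N.d i ^ 2 + N.linearPart i)

variable (hload : ∑ i, (N.Q *ᵥ N.arrival) i = 1)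
include hload

/-- An affine function of the workload has finite expected sum over a busy cycle, bounded by a
quadratic function of the workload at the start. -/
theorem exists_potential_bound {φ : (Fin ℓ → ℕ) → ℝ} (hφ : ∀ y, 0 ≤ φ y) {c₁ c₀ : ℝ}
    (hc₁ : 0 ≤ c₁) (hc₀ : 0 ≤ c₀) (hle : ∀ y, φ y ≤ c₁ * N.f (levels y) + c₀) :
    (∀ y, potential (N.kernel ρ w) 0 (fun z => ENNReal.ofReal (φ z)) y ≠ ⊤) ∧
    ∃ A : ℝ, 0 ≤ A ∧ ∀ y,
      (potential (N.kernel ρ w) 0 (fun z => ENNReal.ofReal (φ z)) y).toReal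
        ≤ A * N.f (levels y) ^ 2 + A * N.f (levels y) + A := by
  have hρ : 0 < 1 - (ρ : ℝ) := sub_pos.2 ρ.2.2
  -- The drift of `α f ^ 2` absorbs `c₁ f`, that of `β f` the remaining constants.
  set α := c₁ / (2 * (1 - ρ)) with hα
  set β := (α * N.dTotal ^ 2 + c₀) / (1 - ρ) with hβ
  have hα0 : 0 ≤ α := by positivity
  have hβ0 : 0 ≤ β := by positivity
  have hα' : α * (2 * (1 - ρ)) = c₁ := div_mul_cancel₀ _ (by positivity)
  have hβ' : β * (1 - ρ) = α * N.dTotal ^ 2 + c₀ := div_mul_cancel₀ _ hρ.ne'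
  set W : (Fin ℓ → ℕ) → ℝ := fun y => α * N.f (levels y) ^ 2 + β * N.f (levels y) with hW
  have hW0 : ∀ y, 0 ≤ W y := fun y => by
    have := N.f_levels_nonneg y
    positivity
  have hint := fun y => N.integrable_kernel ρ w W y
  have hdrift : ∀ y, y ≠ 0 → φ y + ∫ z, W z ∂(N.kernel ρ w y) ≤ W y := by
    intro y hy
    have hi := fun φ => N.integrable_kernel ρ w φ y
    have h1 := integral_f_sq_le N ρ w hload y
    have h2 := integral_f_kernel_of_ne N ρ w hload hy
    rw [integral_sub (hi _) (hi _)] at h2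
    simp only [integral_const, probReal_univ, one_smul] at h2
    rw [hW]
    dsimp only
    rw [integral_add (hi _) (hi _), integral_const_mul, integral_const_mul]
    have h3 := mul_le_mul_of_nonneg_left h1 hα0
    have h4 := hle y
    have h5 : ∫ z, N.f (levels z) ∂(N.kernel ρ w y) = N.f (levels y) - (1 - ρ) := by linarith
    rw [h5]
    have h6 : c₁ * N.f (levels y) = α * (2 * (1 - ρ)) * N.f (levels y) := by rw [hα']
    nlinarith
  have hfin := potential_ne_top_of_drift hφ hW0 hint hdrift
  refine ⟨hfin, ?_⟩
  set G := fun y => (potential (N.kernel ρ w) 0 (fun z => ENNReal.ofReal (φ z)) y).toReal with hG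
  have hG0 : ∀ y, 0 ≤ G y := fun y => ENNReal.toReal_nonneg
  refine ⟨α + β + G 0, add_nonneg (add_nonneg hα0 hβ0) (hG0 0), fun y => ?_⟩
  have hf := N.f_levels_nonneg y
  have hsum : α * N.f (levels y) ^ 2 + β * N.f (levels y) + G 0
      ≤ (α + β + G 0) * N.f (levels y) ^ 2 + (α + β + G 0) * N.f (levels y) + (α + β + G 0) := by
    have := hG0 0
    have h2 : 0 ≤ (β + G 0) * N.f (levels y) ^ 2 := by positivity
    have h1 : 0 ≤ (α + G 0) * N.f (levels y) := by positivity
    linarith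
  refine le_trans ?_ hsum
  change G y ≤ _
  by_cases hy : y = 0
  · rw [hy]
    have := hW0 0
    simp only [hW] at this
    linarith
  · have h1 := (potential_ofReal_le hφ hW0 hint hdrift).1 y hy
    have h2 : G y ≤ W y := by
      have := ENNReal.toReal_mono ENNReal.ofReal_ne_top h1
      rwa [ENNReal.toReal_ofReal (hW0 y)] at this
    have := hG0 0
    simp only [hW] at h2
    linarith

theorem potential_one_ne_top (y : Fin ℓ → ℕ) :
    potential (N.kernel ρ w) 0 (fun _ => ENNReal.ofReal 1) y ≠ ⊤ :=
  (exists_potential_bound N ρ w hload (φ := fun _ => 1) (fun _ => zero_le_one) le_rfl zero_le_one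
    (fun y => by simp)).1 y

theorem potential_one_atom_ne_top : potential (N.kernel ρ w) 0 1 0 ≠ ⊤ := by
  have := potential_one_ne_top N ρ w hload 0
  simpa [Pi.one_def] using this

theorem isProbabilityMeasure_stationary : IsProbabilityMeasure (N.stationary ρ w) :=
  isProbabilityMeasure_cycleProb _ _ (potential_one_atom_ne_top N ρ w hload)

theorem invariant_stationary : Kernel.Invariant (N.kernel ρ w) (N.stationary ρ w) :=
  invariant_cycleProb _ _ (potential_one_atom_ne_top N ρ w hload)

theorem isUniqueStationary : IsUniqueStationary (N.kernel ρ w) (N.stationary ρ w) := by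
  have := isProbabilityMeasure_stationary N ρ w hload
  exact ⟨this, invariant_stationary N ρ w hload, fun ν _ hν =>
    invariant_unique (N.reach_zero ρ w) hν (invariant_stationary N ρ w hload)⟩

/-- The workload has a finite fourth moment. The Lyapunov function is the fifth power. -/
theorem integrable_f_pow_four :
    Integrable (fun y => N.f (levels y) ^ 4) (N.stationary ρ w) := by
  have hρ : 0 < 1 - (ρ : ℝ) := sub_pos.2 ρ.2.2
  obtain ⟨C, hC0, hC⟩ := exists_integral_f_quintic_le N ρ w hload
  have h0 : ∀ y : Fin ℓ → ℕ, 0 ≤ N.f (levels y) ^ 4 := fun y => by positivity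
  refine integrable_cycleProb h0 ?_
  refine potential_ne_top_of_drift h0
    (W := fun y => (1 - (ρ : ℝ))⁻¹ * N.f (levels y) ^ 5
      + ((1 - (ρ : ℝ))⁻¹ * C / (1 - ρ)) * N.f (levels y))
    (fun y => ?_) (fun y => N.integrable_kernel ρ w _ y) (fun y hy => ?_) 0
  · have := N.f_levels_nonneg y
    positivity
  · have hi := fun φ => N.integrable_kernel ρ w φ y
    have h2 := integral_f_kernel_of_ne N ρ w hload hy
    rw [integral_sub (hi _) (hi _)] at h2
    simp only [integral_const, probReal_univ, one_smul] at h2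
    have h5 : ∫ z, N.f (levels z) ∂(N.kernel ρ w y) = N.f (levels y) - (1 - ρ) := by linarith
    rw [integral_add (hi _) (hi _), integral_const_mul, integral_const_mul, h5]
    have h3 := mul_le_mul_of_nonneg_left (hC y) (inv_pos.2 hρ).le
    have h6 : (1 - (ρ : ℝ))⁻¹ * (N.f (levels y) ^ 5 - (1 - ρ) * N.f (levels y) ^ 4 + C)
        = (1 - (ρ : ℝ))⁻¹ * N.f (levels y) ^ 5 - N.f (levels y) ^ 4 + (1 - (ρ : ℝ))⁻¹ * C := by
      field_simp
    have h7 : (1 - (ρ : ℝ))⁻¹ * C / (1 - ρ) * (N.f (levels y) - (1 - ρ))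
        = (1 - (ρ : ℝ))⁻¹ * C / (1 - ρ) * N.f (levels y) - (1 - (ρ : ℝ))⁻¹ * C := by
      field_simp
    linarith

theorem memLp_f_sq : MemLp (fun y => N.f (levels y) ^ 2) 2 (N.stationary ρ w) := by
  rw [memLp_two_iff_integrable_sq (measurable_of_countable _).aestronglyMeasurable]
  refine (integrable_f_pow_four N ρ w hload).congr (ae_of_all _ fun y => ?_)
  ring

/-- Functions of at most quadratic growth in the workload are square integrable. -/
theorem memLp_of_abs_le {ψ : (Fin ℓ → ℕ) → ℝ} {A : ℝ}
    (h : ∀ y, |ψ y| ≤ A * N.f (levels y) ^ 2 + A * N.f (levels y) + A) :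
    MemLp ψ 2 (N.stationary ρ w) := by
  have := isProbabilityMeasure_stationary N ρ w hload
  have h2 : MemLp (fun y => (2 * |A|) * N.f (levels y) ^ 2 + 2 * |A|) 2 (N.stationary ρ w) :=
    ((memLp_f_sq N ρ w hload).const_mul _).add (memLp_const _)
  refine h2.mono (measurable_of_countable _).aestronglyMeasurable (ae_of_all _ fun y => ?_)
  rw [Real.norm_eq_abs, Real.norm_eq_abs]
  refine (h y).trans (le_trans ?_ (le_abs_self _))
  have hf := N.f_levels_nonneg y
  have h3 : A * (N.f (levels y) ^ 2 + N.f (levels y) + 1)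
      ≤ |A| * (N.f (levels y) ^ 2 + N.f (levels y) + 1) :=
    mul_le_mul_of_nonneg_right (le_abs_self A) (by positivity)
  have h4 : |A| * N.f (levels y) ≤ |A| * (N.f (levels y) ^ 2 + 1) :=
    mul_le_mul_of_nonneg_left (by nlinarith [sq_nonneg (N.f (levels y) - 1)]) (abs_nonneg A)
  linarith

theorem memLp_f : MemLp (fun y => N.f (levels y)) 2 (N.stationary ρ w) := by
  refine memLp_of_abs_le N ρ w hload (A := 1) fun y => ?_
  have hf := N.f_levels_nonneg y
  rw [abs_of_nonneg hf]
  nlinarith [sq_nonneg (N.f (levels y))]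

omit hload in
theorem exists_levels_le_f : ∃ c : ℝ, 0 ≤ c ∧ ∀ (y : Fin ℓ → ℕ) (i : Fin ℓ),
    levels y i ≤ c * N.f (levels y) := by
  obtain ⟨m, hm, hmf⟩ := N.exists_le_f
  refine ⟨m⁻¹, by positivity, fun y i => ?_⟩
  have h1 := hmf _ (levels_nonneg y)
  have h2 : levels y i ≤ ∑ i, |levels y i| :=
    (le_abs_self _).trans (Finset.single_le_sum (f := fun i => |levels y i|)
      (fun j _ => abs_nonneg _) (Finset.mem_univ i))
  rw [le_inv_mul_iff₀ hm]
  exact (mul_le_mul_of_nonneg_left h2 hm.le).trans h1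

/-- The buffer levels have square integrable solutions of Poisson's equation. -/
theorem exists_levels_solution (i : Fin ℓ) :
    ∃ h, IsL2PoissonSolution (N.kernel ρ w) (N.stationary ρ w) (fun y => levels y i) h := by
  obtain ⟨c, hc, hle⟩ := N.exists_levels_le_f
  have hpos : ∀ y : Fin ℓ → ℕ, 0 ≤ levels y i := fun y => levels_nonneg y i
  obtain ⟨hfin, A, hA, hbd⟩ := exists_potential_bound N ρ w hload (φ := fun y => levels y i) hpos hc
    le_rfl (fun y => by simpa using hle y i)
  obtain ⟨hfin', A', hA', hbd'⟩ := exists_potential_bound N ρ w hload (φ := fun _ => 1)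
    (fun _ => zero_le_one) le_rfl zero_le_one (fun y => by simp)
  have hsol := integral_poissonPotential hpos hfin hfin'
  refine ⟨poissonPotential (N.kernel ρ w) 0 fun y => levels y i, ?_, ?_, fun y => (hsol y).1,
    fun y => (hsol y).2⟩
  · refine memLp_of_abs_le N ρ w hload (A := c) fun y => ?_
    have hf := N.f_levels_nonneg y
    rw [abs_of_nonneg (hpos y)]
    have := hle y i
    have : 0 ≤ c * N.f (levels y) ^ 2 := by positivity
    linarith
  · exact (memLp_of_abs_le N ρ w hload (A := A) fun y => by
      rw [abs_of_nonneg ENNReal.toReal_nonneg]; exact hbd y).sub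
      ((memLp_of_abs_le N ρ w hload (A := A') fun y => by
      rw [abs_of_nonneg ENNReal.toReal_nonneg]; exact hbd' y).const_mul _)

theorem memLp_workloadSolution :
    MemLp (N.workloadSolution ρ) 2 (N.stationary ρ w) := by
  have h1 : MemLp (fun y => ∑ i, N.poissonVector ρ i * levels y i) 2 (N.stationary ρ w) :=
    memLp_finsetSum _ fun i _ => by
      obtain ⟨h, H⟩ := exists_levels_solution N ρ w hload i
      exact H.memLp_function.const_mul _
  have h2 : MemLp (fun y => (2 * (1 - (ρ : ℝ)))⁻¹ * N.f (levels y) ^ 2) 2 (N.stationary ρ w) :=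
    (memLp_f_sq N ρ w hload).const_mul _
  refine (h2.add h1).ae_eq (ae_of_all _ fun y => ?_)
  simp only [Pi.add_apply, workloadSolution, dotProduct]
  ring

theorem drift_workloadSolution (y : Fin ℓ → ℕ) :
    drift (N.kernel ρ w) (N.workloadSolution ρ) y
      = -N.f (levels y) + ρ * N.meanFactor / (2 * (1 - ρ)) := by
  have hρ : 0 < 1 - (ρ : ℝ) := sub_pos.2 ρ.2.2
  have h := N.drift_quadratic ρ w hload (2 * (1 - (ρ : ℝ)))⁻¹ (N.poissonVector ρ) y
  have hψ : N.workloadSolution ρ = fun z => (2 * (1 - (ρ : ℝ)))⁻¹ * N.f (levels z) ^ 2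
      + N.poissonVector ρ ⬝ᵥ levels z := by
    funext z
    rw [workloadSolution]
    ring
  have hc : ∀ i, (2 * (1 - (ρ : ℝ)))⁻¹ * N.sqDecrement i
      - (N.poissonVector ρ i - ∑ j, N.routing i j * N.poissonVector ρ j) = 0 := by
    intro i
    have h1 := N.visitSum_eq N.sqDecrement i
    have h2 : ∑ j, N.routing i j * N.poissonVector ρ j
        = (2 * (1 - (ρ : ℝ)))⁻¹ * ∑ j, N.routing i j * N.linearPart j := by
      rw [Finset.mul_sum]
      refine Finset.sum_congr rfl fun j _ => ?_
      simp only [poissonVector, Pi.smul_apply, smul_eq_mul]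
      ring
    rw [h2]
    simp only [poissonVector, Pi.smul_apply, smul_eq_mul, linearPart]
    linear_combination -(2 * (1 - (ρ : ℝ)))⁻¹ * h1
  simp only [hc] at h
  rw [hψ, h]
  simp only [mul_zero, Finset.sum_const_zero, add_zero]
  have h3 : ∑ i, N.arrival i * ((2 * (1 - (ρ : ℝ)))⁻¹ * N.d i ^ 2 + N.poissonVector ρ i)
      = (2 * (1 - (ρ : ℝ)))⁻¹ * N.meanFactor := by
    rw [meanFactor, Finset.mul_sum]
    refine Finset.sum_congr rfl fun i _ => ?_
    simp only [poissonVector, Pi.smul_apply, smul_eq_mul]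
    ring
  rw [h3]
  field_simp

theorem integral_f_stationary :
    ∫ y, N.f (levels y) ∂(N.stationary ρ w) = ρ * N.meanFactor / (2 * (1 - ρ)) := by
  have := isProbabilityMeasure_stationary N ρ w hload
  have h := integral_drift_eq_zero (invariant_stationary N ρ w hload)
    ((memLp_workloadSolution N ρ w hload).integrable one_le_two)
  simp only [drift_workloadSolution N ρ w hload] at h
  have hf := (memLp_f N ρ w hload).integrable one_le_two
  rw [integral_add hf.fun_neg (integrable_const _), integral_neg] at h
  simp only [integral_const, probReal_univ, one_smul] at h
  linarith

theorem isL2PoissonSolution_workloadSolution :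
    IsL2PoissonSolution (N.kernel ρ w) (N.stationary ρ w) (fun y => N.f (levels y))
      (N.workloadSolution ρ) where
  memLp_function := memLp_f N ρ w hload
  memLp_solution := memLp_workloadSolution N ρ w hload
  integrable_step := N.integrable_kernel ρ w _
  poisson y := by rw [drift_workloadSolution N ρ w hload, integral_f_stationary N ρ w hload]

theorem isPoissonSolution_workloadSolution :
    IsPoissonSolution (N.kernel ρ w) (N.stationary ρ w) (fun y => N.f (levels y))
      (N.workloadSolution ρ) := by
  have := isProbabilityMeasure_stationary N ρ w hload
  have H := isL2PoissonSolution_workloadSolution N ρ w hload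
  exact ⟨H.memLp_function.integrable one_le_two, H.memLp_solution.integrable one_le_two, H.poisson⟩

theorem ae_eq_workloadSolution {h : (Fin ℓ → ℕ) → ℝ}
    (hh : IsPoissonSolution (N.kernel ρ w) (N.stationary ρ w) (fun y => N.f (levels y)) h) :
    ∃ a : ℝ, ∀ᵐ y ∂(N.stationary ρ w), h y = N.workloadSolution ρ y + a := by
  have := isProbabilityMeasure_stationary N ρ w hload
  have H := isPoissonSolution_workloadSolution N ρ w hload
  have hae := ae_eq_const_of_harmonic (N.reach_zero ρ w) (invariant_stationary N ρ w hload)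
    (g := fun y => h y - N.workloadSolution ρ y) (hh.2.1.sub H.2.1)
    (N.integrable_kernel ρ w _) (fun y => by
      have h1 := hh.2.2 y
      have h2 := H.2.2 y
      rw [drift] at h1 h2
      rw [integral_sub (N.integrable_kernel ρ w _ y) (N.integrable_kernel ρ w _ y)]
      linarith)
  refine ⟨h 0 - N.workloadSolution ρ 0, ?_⟩
  filter_upwards [hae] with y hy
  linarith

/-- The second moment of the workload is at most of order `(1 - ρ)⁻²`. The Lyapunov function is
the cube. -/
theorem integral_f_sq_stationary_le :
    ∫ y, N.f (levels y) ^ 2 ∂(N.stationary ρ w)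
      ≤ (N.dTotal ^ 2 * N.meanFactor + N.dTotal ^ 3) / (1 - ρ) ^ 2 := by
  have hρ : 0 < 1 - (ρ : ℝ) := sub_pos.2 ρ.2.2
  have hρ1 : (ρ : ℝ) < 1 := ρ.2.2
  have hρ0 : 0 < (ρ : ℝ) := ρ.2.1
  have := isProbabilityMeasure_stationary N ρ w hload
  have hf := (memLp_f N ρ w hload).integrable one_le_two
  have hf2 := (memLp_f_sq N ρ w hload).integrable one_le_two
  have hf3 : Integrable (fun y => N.f (levels y) ^ 3) (N.stationary ρ w) := by
    refine ((integrable_f_pow_four N ρ w hload).add (integrable_const 1)).mono'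
      (measurable_of_countable _).aestronglyMeasurable (ae_of_all _ fun y => ?_)
    have h0 := N.f_levels_nonneg y
    rw [Real.norm_eq_abs, abs_of_nonneg (by positivity)]
    simp only [Pi.add_apply]
    rcases le_total (N.f (levels y)) 1 with h | h
    · have h1 : N.f (levels y) ^ 3 ≤ 1 := pow_le_one₀ h0 h
      have : 0 ≤ N.f (levels y) ^ 4 := by positivity
      linarith
    · have := pow_le_pow_right₀ h (show 3 ≤ 4 by norm_num)
      linarith
  have hd := integral_drift_eq_zero (invariant_stationary N ρ w hload) hf3
  have hS := N.dTotal_nonneg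
  have i1 : Integrable (fun y => -(3 * (1 - (ρ : ℝ))) * N.f (levels y) ^ 2) (N.stationary ρ w) :=
    hf2.const_mul _
  have i2 : Integrable (fun y => 3 * N.dTotal ^ 2 * N.f (levels y)) (N.stationary ρ w) :=
    hf.const_mul _
  have i3 : Integrable (fun _ : Fin ℓ → ℕ => N.dTotal ^ 3) (N.stationary ρ w) :=
    integrable_const _
  have i12 : Integrable (fun y => -(3 * (1 - (ρ : ℝ))) * N.f (levels y) ^ 2
      + 3 * N.dTotal ^ 2 * N.f (levels y)) (N.stationary ρ w) := i1.add i2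
  have hle : ∫ y, drift (N.kernel ρ w) (fun y => N.f (levels y) ^ 3) y ∂(N.stationary ρ w)
      ≤ ∫ y, (-(3 * (1 - (ρ : ℝ))) * N.f (levels y) ^ 2 + 3 * N.dTotal ^ 2 * N.f (levels y)
        + N.dTotal ^ 3) ∂(N.stationary ρ w) := by
    refine integral_mono ?_ (i12.add i3) fun y => ?_
    · exact (integrable_integral_of_invariant (invariant_stationary N ρ w hload) hf3).sub hf3
    · have := integral_f_cube_le N ρ w hload y
      simp only [drift]
      linarith
  rw [hd, integral_add i12 i3, integral_add i1 i2, integral_const_mul, integral_const_mul,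
    integral_f_stationary N ρ w hload] at hle
  simp only [integral_const, probReal_univ, one_smul] at hle
  have hM : 0 ≤ N.meanFactor := Finset.sum_nonneg fun i _ =>
    mul_nonneg (N.arrival_nonneg i) (add_nonneg (sq_nonneg _) (N.linearPart_pos i).le)
  set I := ∫ y, N.f (levels y) ^ 2 ∂(N.stationary ρ w)
  rw [le_div_iff₀ (by positivity)]
  have h1 : 3 * N.dTotal ^ 2 * (ρ * N.meanFactor / (2 * (1 - ρ))) * (1 - ρ)
      = 3 / 2 * ρ * (N.dTotal ^ 2 * N.meanFactor) := by
    field_simp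
  have h2 := mul_le_mul_of_nonneg_right hle hρ.le
  have hP : 0 ≤ N.dTotal ^ 2 * N.meanFactor := by positivity
  have hS3 : 0 ≤ N.dTotal ^ 3 := by positivity
  have h3 : ρ * (N.dTotal ^ 2 * N.meanFactor) ≤ N.dTotal ^ 2 * N.meanFactor :=
    mul_le_of_le_one_left hP hρ1.le
  have h4 : N.dTotal ^ 3 * (1 - ρ) ≤ N.dTotal ^ 3 :=
    mul_le_of_le_one_right hS3 (by linarith)
  nlinarith

end Station

/-! ### Order of the variance constants -/

section Gram

variable {Ω : Type*} [MeasurableSpace Ω] {ℓ : ℕ}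

/-- The matrix of the inner products in `L²` of a family of functions. -/
noncomputable def gramMatrix (μ : Measure Ω) (D : Fin ℓ → Ω → ℝ) : Matrix (Fin ℓ) (Fin ℓ) ℝ :=
  Matrix.of fun i j => ∫ x, D i x * D j x ∂μ

theorem gramMatrix_apply (μ : Measure Ω) (D : Fin ℓ → Ω → ℝ) (i j : Fin ℓ) :
    gramMatrix μ D i j = ∫ x, D i x * D j x ∂μ := rfl

/-- The quadratic form of a Gram matrix, and the Cauchy-Schwarz bound for it by the trace. -/
theorem integral_sum_mul_sq {μ : Measure Ω} {D : Fin ℓ → Ω → ℝ} (hD : ∀ i, MemLp (D i) 2 μ)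
    (c : Fin ℓ → ℝ) :
    ∫ x, (∑ i, c i * D i x) ^ 2 ∂μ = c ⬝ᵥ (gramMatrix μ D *ᵥ c) ∧
      ∫ x, (∑ i, c i * D i x) ^ 2 ∂μ ≤ (∑ i, c i ^ 2) * (gramMatrix μ D).trace := by
  have hDi : ∀ i j, Integrable (fun x => D i x * D j x) μ :=
    fun i j => (hD i).integrable_mul (hD j)
  constructor
  · have hexp : ∀ x, (∑ i, c i * D i x) ^ 2 = ∑ i, ∑ j, c i * c j * (D i x * D j x) := by
      intro x
      rw [sq, Finset.sum_mul_sum]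
      exact Finset.sum_congr rfl fun i _ => Finset.sum_congr rfl fun j _ => by ring
    simp only [hexp]
    rw [integral_finsetSum _ fun i _ => integrable_finsetSum _ fun j _ => (hDi i j).const_mul _,
      dotProduct]
    refine Finset.sum_congr rfl fun i _ => ?_
    rw [integral_finsetSum _ fun j _ => (hDi i j).const_mul _, Matrix.mulVec, dotProduct,
      Finset.mul_sum]
    refine Finset.sum_congr rfl fun j _ => ?_
    rw [integral_const_mul, gramMatrix_apply]
    ring
  · simp only [Matrix.trace, Matrix.diag_apply, gramMatrix_apply]
    rw [← integral_finsetSum _ fun i _ => hDi i i, ← integral_const_mul]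
    refine integral_mono (memLp_finsetSum _ fun i _ => (hD i).const_mul _).integrable_sq
      ((integrable_finsetSum _ fun i _ => hDi i i).const_mul _) fun x => ?_
    simp only [← sq]
    exact Finset.sum_mul_sq_le_sq_mul_sq _ _ _

end Gram

namespace Station

variable {ℓ : ℕ} (N : Station ℓ)

theorem sampleMean_apply (n : ℕ) (Y : ℕ → Fin ℓ → ℕ) (i : Fin ℓ) :
    sampleMean n Y i = (n : ℝ)⁻¹ * ∑ k ∈ Finset.range n, levels (Y k) i := by
  simp [sampleMean]

theorem f_sampleMean (n : ℕ) (Y : ℕ → Fin ℓ → ℕ) :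
    N.f (sampleMean n Y) = (n : ℝ)⁻¹ * ∑ k ∈ Finset.range n, N.f (levels (Y k)) := by
  simp only [f, sampleMean]
  rw [dotProduct_smul, dotProduct_sum, smul_eq_mul]

theorem exists_arrival_mul_sq_pos (hload : ∑ i, (N.Q *ᵥ N.arrival) i = 1) :
    0 < ∑ i, N.arrival i * N.d i ^ 2 := by
  have h := N.d_dotProduct_arrival hload
  obtain ⟨i, -, hi⟩ := Finset.exists_ne_zero_of_sum_ne_zero (h ▸ one_ne_zero :
    ∑ i, N.arrival i * N.d i ≠ 0)
  refine Finset.sum_pos' (fun j _ => mul_nonneg (N.arrival_nonneg j) (sq_nonneg _))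
    ⟨i, Finset.mem_univ i, ?_⟩
  have h1 : N.arrival i ≠ 0 := left_ne_zero_of_mul hi
  exact mul_pos (lt_of_le_of_ne (N.arrival_nonneg i) (Ne.symm h1)) (pow_pos (N.d_pos i) 2)

theorem meanFactor_pos (hload : ∑ i, (N.Q *ᵥ N.arrival) i = 1) : 0 < N.meanFactor := by
  refine (N.exists_arrival_mul_sq_pos hload).trans_le (Finset.sum_le_sum fun i _ => ?_)
  exact mul_le_mul_of_nonneg_left (by linarith [N.linearPart_pos i]) (N.arrival_nonneg i)

section

variable (ρ : Set.Ioo (0 : ℝ) 1) (w : NonIdlingPolicy ℓ)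

/-- The time-average variance constant of the workload. -/
noncomputable def workloadVariance : ℝ :=
  ∫ p, poissonIncrement (N.stationary ρ w) (fun y => N.f (levels y)) (N.workloadSolution ρ) p ^ 2
    ∂(N.stationary ρ w ⊗ₘ N.kernel ρ w)

variable (hload : ∑ i, (N.Q *ᵥ N.arrival) i = 1)
include hload

/-- The time-average covariance matrix is the Gram matrix of the martingale increments of the
buffer levels. -/
theorem exists_covariance : ∃ C : Matrix (Fin ℓ) (Fin ℓ) ℝ,
    IsTimeAverageCovariance (N.kernel ρ w) (N.stationary ρ w) C ∧
    (∀ i, IsTAVC (N.kernel ρ w) (N.stationary ρ w) (fun x => x i) (C i i)) ∧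
    IsTAVC (N.kernel ρ w) (N.stationary ρ w) N.f (N.workloadVariance ρ w) ∧
    N.workloadVariance ρ w = N.d ⬝ᵥ (C *ᵥ N.d) ∧
    N.workloadVariance ρ w ≤ (∑ i, N.d i ^ 2) * Matrix.trace C := by
  have hprob := isProbabilityMeasure_stationary N ρ w hload
  have hinv := invariant_stationary N ρ w hload
  choose h H using exists_levels_solution N ρ w hload
  have hD := fun i => memLp_poissonIncrement hinv (H i)
  obtain ⟨hquad, htrace⟩ := integral_sum_mul_sq hD N.d
  -- Two solutions for the workload: the explicit one, and the combination of those for the levels.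
  have hW := tendsto_variance_mean hinv (isL2PoissonSolution_workloadSolution N ρ w hload)
  have hW' := tendsto_variance_mean hinv (IsL2PoissonSolution.linearCombination H N.d)
  have heq : N.workloadVariance ρ w = _ := tendsto_nhds_unique hW hW'
  simp only [IsL2PoissonSolution.poissonIncrement_linearCombination H N.d] at heq
  refine ⟨gramMatrix (N.stationary ρ w ⊗ₘ N.kernel ρ w) fun i =>
      poissonIncrement (N.stationary ρ w) (fun y => levels y i) (h i),
    ⟨fun i => (H i).memLp_function, fun i j => ?_⟩,
    fun i => ⟨(H i).memLp_function, ?_⟩, ⟨memLp_f N ρ w hload, ?_⟩, heq.trans hquad,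
    heq.trans_le htrace⟩
  · simp only [sampleMean_apply, gramMatrix_apply]
    have h1 := tendsto_covariance_mean hinv (H i) (H j)
    exact h1
  · simp only [sampleMean_apply, gramMatrix_apply, ← sq]
    have h1 := tendsto_variance_mean hinv (H i)
    exact h1
  · simp only [f_sampleMean]
    exact hW

theorem workloadVariance_eq : N.workloadVariance ρ w
    = ∫ y, ∫ z, poissonIncrement (N.stationary ρ w) (fun y => N.f (levels y))
        (N.workloadSolution ρ) (y, z) ^ 2 ∂(N.kernel ρ w y) ∂(N.stationary ρ w) := by
  have hprob := isProbabilityMeasure_stationary N ρ w hload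
  exact Measure.integral_compProd (memLp_poissonIncrement (invariant_stationary N ρ w hload)
    (isL2PoissonSolution_workloadSolution N ρ w hload)).integrable_sq

theorem integrable_integral_increment_sq : Integrable (fun y =>
    ∫ z, poissonIncrement (N.stationary ρ w) (fun y => N.f (levels y))
        (N.workloadSolution ρ) (y, z) ^ 2 ∂(N.kernel ρ w y)) (N.stationary ρ w) := by
  have hprob := isProbabilityMeasure_stationary N ρ w hload
  have h := (memLp_poissonIncrement (invariant_stationary N ρ w hload)
    (isL2PoissonSolution_workloadSolution N ρ w hload)).integrable_sq
  rw [Measure.compProd] at h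
  simpa using h.integral_compProd

theorem abs_workload_increment_le {y z : Fin ℓ → ℕ} (h : ∀ i, |levels z i - levels y i| ≤ 1) :
    |poissonIncrement (N.stationary ρ w) (fun y => N.f (levels y)) (N.workloadSolution ρ) (y, z)|
      ≤ ((N.dTotal + 1) * N.f (levels y)
          + (N.dTotal ^ 2 + ∑ i, N.linearPart i + N.meanFactor)) / (1 - ρ) := by
  have hρ : 0 < 1 - (ρ : ℝ) := sub_pos.2 ρ.2.2
  have hρ0 : 0 < (ρ : ℝ) := ρ.2.1
  have hM := N.meanFactor_pos hload
  have hS := N.dTotal_nonneg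
  have hf := N.f_levels_nonneg y
  have h1 := N.abs_f_sub_le h
  have h2 := abs_dotProduct_sub_le (fun i => (N.linearPart_pos i).le) h
  set U := ∑ i, N.linearPart i
  have e : poissonIncrement (N.stationary ρ w) (fun y => N.f (levels y))
      (N.workloadSolution ρ) (y, z)
      = ((2 * N.f (levels y) * (N.f (levels z) - N.f (levels y))
          + (N.f (levels z) - N.f (levels y)) ^ 2
          + (N.linearPart ⬝ᵥ levels z - N.linearPart ⬝ᵥ levels y)) / 2
          + (1 - ρ) * N.f (levels y) - ρ * N.meanFactor / 2) / (1 - ρ) := by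
    simp only [poissonIncrement, workloadSolution, poissonVector, smul_dotProduct, smul_eq_mul,
      integral_f_stationary N ρ w hload]
    field_simp
    ring
  rw [e, abs_div, abs_of_pos hρ]
  gcongr
  set t := N.f (levels z) - N.f (levels y)
  have ht1 : |N.f (levels y) * t| ≤ N.f (levels y) * N.dTotal := by
    rw [abs_mul, abs_of_nonneg hf]
    gcongr
  have ht2 : t ^ 2 ≤ N.dTotal ^ 2 := sq_le_sq' (neg_le_of_abs_le h1) (le_of_abs_le h1)
  have ht3 : 0 ≤ t ^ 2 := sq_nonneg t
  have hrf : (1 - ρ) * N.f (levels y) ≤ N.f (levels y) := mul_le_of_le_one_left hf (by linarith)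
  have hrf0 : 0 ≤ (1 - ρ) * N.f (levels y) := by positivity
  have hrM : ρ * N.meanFactor ≤ N.meanFactor := mul_le_of_le_one_left hM.le (by linarith)
  have hrM0 : 0 ≤ ρ * N.meanFactor := by positivity
  rw [abs_le] at ht1 h2 ⊢
  have hU : 0 ≤ U := by linarith
  constructor <;> linarith

theorem workloadVariance_le : N.workloadVariance ρ w
    ≤ 2 * ((N.dTotal + 1) ^ 2 * (N.dTotal ^ 2 * N.meanFactor + N.dTotal ^ 3)
      + (N.dTotal ^ 2 + ∑ i, N.linearPart i + N.meanFactor) ^ 2) / (1 - (ρ : ℝ)) ^ 4 := by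
  have hprob := isProbabilityMeasure_stationary N ρ w hload
  have hρ : 0 < 1 - (ρ : ℝ) := sub_pos.2 ρ.2.2
  have hρ0 : 0 < (ρ : ℝ) := ρ.2.1
  set a := N.dTotal + 1
  set b := N.dTotal ^ 2 + ∑ i, N.linearPart i + N.meanFactor
  set B := N.dTotal ^ 2 * N.meanFactor + N.dTotal ^ 3
  have hf2 := (memLp_f_sq N ρ w hload).integrable one_le_two
  have hI := integral_f_sq_stationary_le N ρ w hload
  have hi : Integrable (fun y => 2 * (a ^ 2 * N.f (levels y) ^ 2 + b ^ 2) / (1 - (ρ : ℝ)) ^ 2)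
      (N.stationary ρ w) :=
    (((hf2.const_mul (a ^ 2)).add (integrable_const (b ^ 2))).const_mul 2).div_const _
  rw [workloadVariance_eq N ρ w hload]
  calc _ ≤ ∫ y, 2 * (a ^ 2 * N.f (levels y) ^ 2 + b ^ 2) / (1 - (ρ : ℝ)) ^ 2
        ∂(N.stationary ρ w) := by
        refine integral_mono (integrable_integral_increment_sq N ρ w hload) hi fun y => ?_
        have hik := fun φ => N.integrable_kernel ρ w φ y
        dsimp only
        have h1 := integral_mono_ae (hik (fun z => poissonIncrement (N.stationary ρ w)
            (fun y => N.f (levels y)) (N.workloadSolution ρ) (y, z) ^ 2))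
          (hik fun _ => 2 * (a ^ 2 * N.f (levels y) ^ 2 + b ^ 2) / (1 - (ρ : ℝ)) ^ 2)
          (N.ae_kernel ρ w fun z hz => ?_)
        · simpa using h1
        · have h2 := abs_workload_increment_le N ρ w hload hz
          have h3 := pow_le_pow_left₀ (abs_nonneg _) h2 2
          rw [sq_abs, div_pow] at h3
          refine h3.trans (div_le_div_of_nonneg_right ?_ (sq_nonneg _))
          nlinarith [sq_nonneg (a * N.f (levels y) - b)]
    _ = 2 * (a ^ 2 * ∫ y, N.f (levels y) ^ 2 ∂(N.stationary ρ w) + b ^ 2)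
          / (1 - (ρ : ℝ)) ^ 2 := by
        rw [integral_div, integral_const_mul, integral_add (hf2.const_mul (a ^ 2))
          (integrable_const _), integral_const_mul]
        simp
    _ ≤ 2 * (a ^ 2 * (B / (1 - (ρ : ℝ)) ^ 2) + b ^ 2 / (1 - (ρ : ℝ)) ^ 2)
          / (1 - (ρ : ℝ)) ^ 2 := by
        gcongr
        rw [le_div_iff₀ (by positivity)]
        exact mul_le_of_le_one_right (sq_nonneg b) (pow_le_one₀ hρ.le (by linarith))
    _ = _ := by field_simp

/-- Only the arrivals are needed for a lower bound: an arrival moves the solution of Poisson's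
equation by at least `f y * d i / (1 - ρ)`. -/
theorem le_workloadVariance :
    (ρ * N.meanFactor / (2 * (1 - ρ))) ^ 2
        * (ρ * (∑ i, N.arrival i * N.d i ^ 2) / (2 * (1 - ρ) ^ 2) - 1)
      ≤ N.workloadVariance ρ w := by
  have hprob := isProbabilityMeasure_stationary N ρ w hload
  have hρ : 0 < 1 - (ρ : ℝ) := sub_pos.2 ρ.2.2
  have hρ0 : 0 < (ρ : ℝ) := ρ.2.1
  set κ := ρ * N.meanFactor / (2 * (1 - ρ)) with hκ
  set v := ∑ i, N.arrival i * N.d i ^ 2 with hv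
  have hv0 := N.exists_arrival_mul_sq_pos hload
  have hκ0 : 0 ≤ κ := by
    have := N.meanFactor_pos hload
    positivity
  have hf := memLp_f N ρ w hload
  have hf2 := (memLp_f_sq N ρ w hload).integrable one_le_two
  have hmean := integral_f_stationary N ρ w hload
  rw [← hκ] at hmean
  have hjensen : κ ^ 2 ≤ ∫ y, N.f (levels y) ^ 2 ∂(N.stationary ρ w) := by
    have h1 := variance_nonneg (fun y => N.f (levels y)) (N.stationary ρ w)
    rw [variance_eq_sub hf, hmean] at h1
    simp only [Pi.pow_apply] at h1
    linarith
  have hcoef : 0 ≤ ρ * v / (2 * (1 - (ρ : ℝ)) ^ 2) := by positivity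
  have hpt : ∀ y, ρ * v / (2 * (1 - (ρ : ℝ)) ^ 2) * N.f (levels y) ^ 2 - κ ^ 2
      ≤ ∫ z, poissonIncrement (N.stationary ρ w) (fun y => N.f (levels y))
        (N.workloadSolution ρ) (y, z) ^ 2 ∂(N.kernel ρ w y) := by
    intro y
    have hfy := N.f_levels_nonneg y
    refine le_trans ?_ (N.sum_arrival_mul_le_integral ρ w (fun z => sq_nonneg _) y)
    have hterm : ∀ i, (N.f (levels y) * N.d i / (1 - ρ)) ^ 2 / 2 - κ ^ 2
        ≤ poissonIncrement (N.stationary ρ w) (fun y => N.f (levels y))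
          (N.workloadSolution ρ) (y, y + Pi.single i 1) ^ 2 := by
      intro i
      have hd := (N.d_pos i).le
      have hu := (N.linearPart_pos i).le
      have e : poissonIncrement (N.stationary ρ w) (fun y => N.f (levels y))
          (N.workloadSolution ρ) (y, y + Pi.single i 1)
          = N.f (levels y) * N.d i / (1 - ρ)
            + ((N.d i ^ 2 + N.linearPart i) / (2 * (1 - ρ)) + N.f (levels y)) - κ := by
        have hadd : N.f (levels (y + Pi.single i 1)) = N.f (levels y) + N.d i :=
          dotProduct_levels_add N.d y i
        simp only [poissonIncrement, workloadSolution, poissonVector, smul_dotProduct, smul_eq_mul,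
          hmean, hadd, dotProduct_levels_add]
        field_simp
        ring
      rw [e]
      set P := N.f (levels y) * N.d i / (1 - ρ) with hP
      have hP0 : 0 ≤ P := by positivity
      have hr : 0 ≤ (N.d i ^ 2 + N.linearPart i) / (2 * (1 - ρ)) + N.f (levels y) := by positivity
      set r := (N.d i ^ 2 + N.linearPart i) / (2 * (1 - ρ)) + N.f (levels y)
      have h1 : (P + r) ^ 2 / 2 - κ ^ 2 ≤ (P + r - κ) ^ 2 := by
        nlinarith [sq_nonneg (P + r - 2 * κ)]
      have h2 : P ^ 2 ≤ (P + r) ^ 2 := by gcongr; linarith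
      linarith
    have hsum : ∑ i, (ρ : ℝ) * N.arrival i ≤ 1 := by
      have := N.idleRate_nonneg ρ w 0
      have h3 : 0 ≤ ∑ i, N.service i * w.alloc 0 i := Finset.sum_nonneg fun i _ =>
        mul_nonneg (N.service_pos i).le (w.alloc_nonneg 0 i)
      linarith
    calc ρ * v / (2 * (1 - (ρ : ℝ)) ^ 2) * N.f (levels y) ^ 2 - κ ^ 2
        ≤ ρ * v / (2 * (1 - (ρ : ℝ)) ^ 2) * N.f (levels y) ^ 2
          - (∑ i, (ρ : ℝ) * N.arrival i) * κ ^ 2 := by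
          have := mul_le_of_le_one_left (sq_nonneg κ) hsum
          linarith
      _ = ∑ i, (ρ * N.arrival i) * ((N.f (levels y) * N.d i / (1 - ρ)) ^ 2 / 2 - κ ^ 2) := by
          simp only [mul_sub, Finset.sum_sub_distrib, ← Finset.sum_mul]
          congr 1
          rw [hv, Finset.mul_sum, Finset.sum_div, Finset.sum_mul]
          refine Finset.sum_congr rfl fun i _ => ?_
          field_simp
      _ ≤ _ := Finset.sum_le_sum fun i _ =>
          mul_le_mul_of_nonneg_left (hterm i) (N.arrivalRate_nonneg ρ i)
  rw [workloadVariance_eq N ρ w hload]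
  have hi1 := hf2.const_mul (ρ * v / (2 * (1 - (ρ : ℝ)) ^ 2))
  have h := integral_mono (hi1.sub (integrable_const (κ ^ 2)))
    (integrable_integral_increment_sq N ρ w hload) hpt
  refine le_trans ?_ h
  simp only [Pi.sub_apply]
  rw [integral_sub hi1 (integrable_const _), integral_const_mul]
  simp only [integral_const, probReal_univ, one_smul]
  have := mul_le_mul_of_nonneg_left hjensen hcoef
  linarith

theorem exists_le_workloadVariance : ∃ A ρ₀ : ℝ, 0 < A ∧ ρ₀ < 1 ∧
    ∀ (ρ : Set.Ioo (0 : ℝ) 1) (w : NonIdlingPolicy ℓ), ρ₀ < (ρ : ℝ) →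
      A / (1 - (ρ : ℝ)) ^ 4 ≤ N.workloadVariance ρ w := by
  set v := ∑ i, N.arrival i * N.d i ^ 2 with hv
  have hv0 : 0 < v := N.exists_arrival_mul_sq_pos hload
  have hM := N.meanFactor_pos hload
  refine ⟨N.meanFactor ^ 2 * v / 128, max (1 / 2) (1 - v / 8), by positivity,
    max_lt (by norm_num) (by linarith), fun ρ w hρρ => ?_⟩
  have hρ : 0 < 1 - (ρ : ℝ) := sub_pos.2 ρ.2.2
  have h1 : 1 / 2 < (ρ : ℝ) := (le_max_left _ _).trans_lt hρρ
  have h2 : 1 - (ρ : ℝ) < v / 8 := by linarith [(le_max_right (1 / 2) (1 - v / 8)).trans_lt hρρ]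
  refine le_trans ?_ (le_workloadVariance N ρ w hload)
  set t := 1 - (ρ : ℝ) with ht
  have ht1 : t ≤ 1 := by linarith [ρ.2.1]
  have hA : N.meanFactor / (4 * t) ≤ ρ * N.meanFactor / (2 * t) := by
    rw [div_le_div_iff₀ (by positivity) (by positivity)]
    nlinarith [mul_pos hM hρ]
  -- Close to `ρ = 1` the constant `1` is at most half of the main term.
  have hB : v / (8 * t ^ 2) ≤ ρ * v / (2 * t ^ 2) - 1 := by
    have h3 : v / (4 * t ^ 2) ≤ ρ * v / (2 * t ^ 2) := by
      rw [div_le_div_iff₀ (by positivity) (by positivity)]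
      nlinarith [mul_pos hv0 (pow_pos hρ 2)]
    have h4 : 1 ≤ v / (8 * t ^ 2) := by
      rw [one_le_div (by positivity)]
      nlinarith
    have h5 : v / (4 * t ^ 2) = v / (8 * t ^ 2) + v / (8 * t ^ 2) := by
      field_simp
      norm_num
    linarith
  calc N.meanFactor ^ 2 * v / 128 / t ^ 4 = (N.meanFactor / (4 * t)) ^ 2 * (v / (8 * t ^ 2)) := by
        field_simp
        norm_num
    _ ≤ _ := by gcongr

omit hload in
theorem sum_abs_poissonVector :
    ∑ i, |N.poissonVector ρ i| = (∑ i, N.linearPart i) / 2 / (1 - (ρ : ℝ)) := by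
  have hρ : 0 < 1 - (ρ : ℝ) := sub_pos.2 ρ.2.2
  rw [Finset.sum_div, Finset.sum_div]
  refine Finset.sum_congr rfl fun i _ => ?_
  have hu := N.linearPart_pos i
  rw [poissonVector, Pi.smul_apply, smul_eq_mul, abs_of_pos (by positivity)]
  field_simp

end

end Station

theorem theorem2 {ℓ : ℕ} (N : Station ℓ)
    (hload : ∑ i, (N.Q *ᵥ N.arrival) i = 1)
    (w : Set.Ioo (0 : ℝ) 1 → NonIdlingPolicy ℓ) :
    ∃ (π : Set.Ioo (0 : ℝ) 1 → Measure (Fin ℓ → ℕ))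
      (sf : Set.Ioo (0 : ℝ) 1 → ℝ)
      (s : Set.Ioo (0 : ℝ) 1 → Fin ℓ → ℝ)
      (C : Set.Ioo (0 : ℝ) 1 → Matrix (Fin ℓ) (Fin ℓ) ℝ)
      (c : Set.Ioo (0 : ℝ) 1 → Fin ℓ → ℝ),
      (∀ ρ : Set.Ioo (0 : ℝ) 1,
        IsUniqueStationary (N.kernel ρ (w ρ)) (π ρ) ∧
        (∃ b₀ : ℝ, 0 < b₀ ∧ ∀ b : ℝ, b₀ ≤ b →
          SatisfiesA (N.kernel ρ (w ρ)) (fun x => b * N.f x ^ 5 + 1)) ∧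
        IsTAVC (N.kernel ρ (w ρ)) (π ρ) N.f (sf ρ) ∧
        (∀ i, IsTAVC (N.kernel ρ (w ρ)) (π ρ) (fun x => x i) (s ρ i)) ∧
        IsTimeAverageCovariance (N.kernel ρ (w ρ)) (π ρ) (C ρ) ∧
        sf ρ = N.d ⬝ᵥ (C ρ *ᵥ N.d) ∧
        (∀ i, s ρ i = C ρ i i) ∧
        IsPoissonSolution (N.kernel ρ (w ρ)) (π ρ) (fun y => N.f (levels y))
          (fun y => N.f (levels y) ^ 2 / (2 * (1 - (ρ : ℝ))) + c ρ ⬝ᵥ levels y) ∧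
        (∀ h : (Fin ℓ → ℕ) → ℝ,
          IsPoissonSolution (N.kernel ρ (w ρ)) (π ρ) (fun y => N.f (levels y)) h →
          ∃ a : ℝ, ∀ᵐ y ∂(π ρ),
            h y = N.f (levels y) ^ 2 / (2 * (1 - (ρ : ℝ))) + c ρ ⬝ᵥ levels y + a)) ∧
      (∃ k₁ k₂ : ℝ, 0 < k₁ ∧ 0 < k₂ ∧ ∀ ρ : Set.Ioo (0 : ℝ) 1,
        k₁ / (1 - (ρ : ℝ)) ≤ ∑ i, |c ρ i| ∧ ∑ i, |c ρ i| ≤ k₂ / (1 - (ρ : ℝ))) ∧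
      (∃ A B A' ρ₀ : ℝ, 0 < A ∧ 0 < B ∧ 0 < A' ∧ ρ₀ < 1 ∧
        ∀ ρ : Set.Ioo (0 : ℝ) 1, ρ₀ < (ρ : ℝ) →
          A / (1 - (ρ : ℝ)) ^ 4 ≤ sf ρ ∧ sf ρ ≤ B / (1 - (ρ : ℝ)) ^ 4 ∧
          Matrix.trace (C ρ) = ∑ i, s ρ i ∧
          A' / (1 - (ρ : ℝ)) ^ 4 ≤ Matrix.trace (C ρ)) := by
  have hC := fun ρ : Set.Ioo (0 : ℝ) 1 => N.exists_covariance ρ (w ρ) hload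
  choose C hcov hs hsf hsfC htrace using hC
  have := N.nonempty_class
  have hU : 0 < ∑ i, N.linearPart i :=
    Finset.sum_pos (fun i _ => N.linearPart_pos i) Finset.univ_nonempty
  have hd2 : 0 < ∑ i, N.d i ^ 2 :=
    Finset.sum_pos (fun i _ => pow_pos (N.d_pos i) 2) Finset.univ_nonempty
  have hM := N.meanFactor_pos hload
  have hS := N.dTotal_nonneg
  refine ⟨fun ρ => N.stationary ρ (w ρ), fun ρ => N.workloadVariance ρ (w ρ),
    fun ρ i => C ρ i i, C, N.poissonVector, fun ρ => ⟨N.isUniqueStationary ρ (w ρ) hload,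
      N.exists_satisfiesA ρ (w ρ) hload, hsf ρ, hs ρ, hcov ρ, hsfC ρ, fun i => rfl,
      N.isPoissonSolution_workloadSolution ρ (w ρ) hload, fun h hh => ?_⟩, ?_, ?_⟩
  · exact N.ae_eq_workloadSolution ρ (w ρ) hload hh
  · exact ⟨(∑ i, N.linearPart i) / 2, (∑ i, N.linearPart i) / 2, by positivity, by positivity,
      fun ρ => ⟨(N.sum_abs_poissonVector ρ).ge, (N.sum_abs_poissonVector ρ).le⟩⟩
  · obtain ⟨A, ρ₀, hA, hρ₀, hlow⟩ := N.exists_le_workloadVariance hload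
    refine ⟨A, _, A / ∑ i, N.d i ^ 2, ρ₀, hA, ?_, by positivity, hρ₀, fun ρ hρ =>
      ⟨hlow ρ (w ρ) hρ, N.workloadVariance_le ρ (w ρ) hload, rfl, ?_⟩⟩
    · positivity
    · have h1 := (hlow ρ (w ρ) hρ).trans (htrace ρ)
      rw [div_right_comm, div_le_iff₀' hd2]
      exact h1
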